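/- All fields have characteristic zero. Let $k'/k$ be a (not necessarily finite) Galois extension with group $\Gamma=\mathrm{Gal}(k'/k)$. A variety over a field is a separated, geometrically integral scheme of finite type. A $k$-structure $\sigma$ on a $k'$-variety $X$ is a family of automorphisms $(\sigma_\gamma)_{\gamma\in\Gamma}$ of the scheme $X$, each lying over $\mathrm{Spec}(\gamma)$, with $\sigma_{\gamma_1\gamma_2}=\sigma_{\gamma_2}\circ\sigma_{\gamma_1}$, that is continuous: for some finite Galois extension $k_1/k$ inside $k'$ there is a $k_1$-variety $X_1$ with $X_1\times_{k_1}k'\cong X$ such that $\sigma_\gamma=\mathrm{id}\times\mathrm{Spec}(\gamma)$ for all $\gamma\in\mathrm{Gal}(k'/k_1)$. A morphism $f$ over $k'$ between varieties with $k$-structures $\sigma,\sigma'$ is a $k$-morphism if $\sigma'_\gamma\circ f=f\circ\sigma_\gamma$ for all $\gamma$. A $k$-group structure on an algebraic $k'$-group is a $k$-structure for which multiplication, inverse and unit are $k$-morphisms. Let $M$ be a lattice of rank $d$, let $\mathbb T=\mathrm{Spec}(k'[M])$ be the corresponding $d$-dimensional torus, with a $k$-group structure $\tau$, and let $X$ be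 an affine $k'$-variety with a $k$-structure $\sigma$. Let $\mu:\mathbb T\times X\to X$ be an effective action such that $(\mathbb T,\tau)$ acts on $(X,\sigma)$, i.e. $\sigma_\gamma\circ\mu=\mu\circ(\tau_\gamma\times\sigma_\gamma)$ for all $\gamma\in\Gamma$. Then there is an integer $n\ge d$ such that: (i) there are a $k$-group structure $\tau'$ on $\mathbb G_{m,k'}^n$ and a $k$-structure $\sigma'$ on $\mathbb A^n_{k'}$ extending it along the inclusion $\mathbb G_{m,k'}^n\subset\mathbb A^n_{k'}$; (ii) $(\mathbb T,\tau)$ is a closed subgroup of $(\mathbb G_{m,k'}^n,\tau')$, i.e. there is a closed immersion $j:\mathbb T\to\mathbb G_{m,k'}^n$ that is a group homomorphism and a $k$-morphism; (iii) for the action of $\mathbb T$ on $\mathbb A^n_{k'}$ obtained from the natural action of $\mathbb G_{m,k'}^n$ through $j$, $(\mathbb T,\tau)$ acts on $(\mathbb A^n_{k'},\sigma')$, and there is a $\mathbb T$-equivariant closed immersion $X\to\mathbb A^n_{k'}$ that is a $k$-morphism $(X,\sigma)\to(\mathbb A^n_{k'},\sigma')$, whose image meets the dense open orbit $\mathbb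 G_{m,k'}^n$ of $\mathbb A^n_{k'}$. Moreover, the weight cones of the $\mathbb T$-actions on $\mathbb A^n_{k'}$ and on $X$ are equal. Here the weight cone of a $\mathbb T$-action $\mu$ on an affine variety $Z$ is the cone in $M\otimes_{\mathbb Z}\mathbb Q$ spanned by those $m\in M$ for which there is a non-zero $f\in k'[Z]$ with $\mu^\sharp(f)=\chi^m\otimes f$. -/

import Mathlib

open CategoryTheory AlgebraicGeometry Limits MonoidalCategory CartesianMonoidalCategory
open scoped TensorProduct

universe u

noncomputable section

namespace GaloisTorus

/-- Varieties over a field `K`: separated, geometrically integral schemes of finite type over `K`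
(finite type = locally of finite type and quasi-compact). -/
structure IsVariety {K : Type u} [Field K] (X : Over (Spec (.of K))) : Prop where
  separated : IsSeparated X.hom
  locallyOfFiniteType : LocallyOfFiniteType X.hom
  quasiCompact : QuasiCompact X.hom
  geometricallyIntegral : GeometricallyIntegral X.hom

/-! ### Galois descent data -/

section Descent

variable (k : Type u) {k' : Type u} [Field k] [Field k'] [Algebra k k']

/-- The automorphism `Spec(γ)` of `Spec(k')` attached to `γ ∈ Gal(k'/k)`. -/
def specGal (γ : k' ≃ₐ[k] k') : Spec (.of k') ⟶ Spec (.of k') :=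
  Spec.map (CommRingCat.ofHom (γ : k' →+* k'))

/-- A `k`-structure on a scheme `X` over `k'`: a continuous semilinear action of `Γ = Gal(k'/k)`
by automorphisms of the `k`-scheme `X`, with `σ_{γ₁γ₂} = σ_{γ₂} ∘ σ_{γ₁}`.
(Each `σ_γ` is an automorphism, with inverse `σ_{γ⁻¹}`, and it is a morphism over `k` by
semilinearity.) -/
structure KStructure (X : Over (Spec (.of k'))) where
  /-- the automorphism `σ_γ` -/
  act : (k' ≃ₐ[k] k') → (X.left ⟶ X.left)
  act_one : act 1 = 𝟙 X.left
  act_mul : ∀ γ₁ γ₂, act (γ₁ * γ₂) = act γ₁ ≫ act γ₂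
  semilinear : ∀ γ, act γ ≫ X.hom = X.hom ≫ specGal k γ
  /-- There are a finite Galois extension `K₁/k` inside `k'` and a `K₁`-form `X₁` of `X`
  (that is, `X ≅ X₁ ×_{K₁} k'`, the first projection being `p`) such that `Gal(k'/K₁)` acts on `X`
  in the natural way, `σ_γ = id × Spec(γ)`. By semilinearity the second component of `σ_γ` is
  `Spec(γ)` anyhow, so that this says `p ∘ σ_γ = p`. -/
  continuous : ∃ K₁ : IntermediateField k k', FiniteDimensional k K₁ ∧ IsGalois k K₁ ∧
    ∃ X₁ : Over (Spec (.of K₁)), IsVariety X₁ ∧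
    ∃ p : X.left ⟶ X₁.left,
      IsPullback p X.hom X₁.hom (Spec.map (CommRingCat.ofHom (algebraMap K₁ k'))) ∧
      ∀ γ ∈ K₁.fixingSubgroup, act γ ≫ p = p

variable {k}

/-- The product automorphism `σ_γ × τ_γ` of `X ×_{k'} Y` (semilinear over `γ`). -/
def KStructure.prodAct {X Y : Over (Spec (.of k'))} (σ : KStructure k X) (τ : KStructure k Y)
    (γ : k' ≃ₐ[k] k') : (X ⊗ Y).left ⟶ (X ⊗ Y).left :=
  pullback.map X.hom Y.hom X.hom Y.hom (σ.act γ) (τ.act γ) (specGal k γ)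
    (σ.semilinear γ).symm (τ.semilinear γ).symm

/-- A morphism over `k'` is compatible with `k`-structures (is a `k`-morphism). -/
def IsKMorphism {X Y : Over (Spec (.of k'))} (σ : KStructure k X) (τ : KStructure k Y)
    (f : X ⟶ Y) : Prop :=
  ∀ γ, σ.act γ ≫ f.left = f.left ≫ τ.act γ

/-- A `k`-structure on a group scheme `G` over `k'` is a `k`-group structure if multiplication,
inverse and unit are `k`-morphisms. -/
structure KStructure.IsGroupStructure {G : Over (Spec (.of k'))} [GrpObj G]
    (τ : KStructure k G) : Prop where
  mul : ∀ γ, τ.prodAct τ γ ≫ (MonObj.mul (X := G)).left = (MonObj.mul (X := G)).left ≫ τ.act γ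
  inv : IsKMorphism τ τ (GrpObj.inv (X := G))
  one : ∀ γ, specGal k γ ≫ (MonObj.one (X := G)).left = (MonObj.one (X := G)).left ≫ τ.act γ

/-- The action morphism `a : G × X ⟶ X` is compatible with the `k`-structures `τ` on `G` and `σ`
on `X`: "`(G, τ)` acts on `(X, σ)`". -/
def ActsOver {G X : Over (Spec (.of k'))} (τ : KStructure k G) (σ : KStructure k X)
    (a : G ⊗ X ⟶ X) : Prop :=
  ∀ γ, τ.prodAct σ γ ≫ a.left = a.left ≫ σ.act γ

end Descent

/-! ### Group actions, split tori and affine spaces -/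

section Torus

variable (K : Type u) [Field K]

/-- An action `a : G × X ⟶ X` is effective if only the unit acts trivially: a point `t ∈ G(S)`,
`S` any scheme over `K`, that acts trivially on `S × X` is the unit of `G(S)`. -/
def IsEffective {K : Type u} [Field K] {G X : Over (Spec (.of K))} [GrpObj G]
    (a : G ⊗ X ⟶ X) : Prop :=
  ∀ (S : Over (Spec (.of K))) (t : S ⟶ G), (t ▷ X) ≫ a = snd S X →
    t = toUnit S ≫ MonObj.one (X := G)

/-- The split torus `Spec K[M]`, a group scheme over `K`; its group structure (an instance of
Mathlib) comes from the Hopf algebra structure of `K[M]`, `χ^m ↦ χ^m ⊗ χ^m`. -/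
abbrev splitTorus (M : Type u) [AddCommGroup M] : Over (Spec (.of K)) :=
  (Spec (.of (AddMonoidAlgebra K M))).asOver (Spec (.of K))

/-- `𝔾_m^n = Spec K[x₁^{±1}, …, x_n^{±1}]`, the split torus with character lattice `ℤ^n`. -/
abbrev Gm (n : ℕ) : Over (Spec (.of K)) :=
  (Spec (.of (AddMonoidAlgebra K (Fin n → ℤ)))).asOver (Spec (.of K))

/-- `𝔸^n = Spec K[x₁, …, x_n]`. -/
abbrev affineSp (n : ℕ) : Over (Spec (.of K)) :=
  (Spec (.of (MvPolynomial (Fin n) K))).asOver (Spec (.of K))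

/-- The coordinate `x_i`, seen as an element of `K[x₁^{±1}, …, x_n^{±1}] = K[ℤ^n]`. -/
def gmCoord (n : ℕ) (i : Fin n) : AddMonoidAlgebra K (Fin n → ℤ) :=
  AddMonoidAlgebra.single (Pi.single i 1) 1

/-- The inclusion `𝔾_m^n ⊂ 𝔸^n`, given by `K[x₁, …, x_n] ⊂ K[x₁^{±1}, …, x_n^{±1}]`; this is
the orbit map of the point `(1, …, 1)`, and its range is the dense open orbit of `𝔾_m^n`. -/
def gmInclusion (n : ℕ) : Gm K n ⟶ affineSp K n :=
  Scheme.Hom.asOver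
    (Spec.map (CommRingCat.ofHom (MvPolynomial.aeval (R := K) (gmCoord K n)).toRingHom))
    (Spec (.of K))

/-- The comorphism `x_i ↦ x_i ⊗ x_i` of the natural action of `𝔾_m^n` on `𝔸^n`. -/
def gmCoaction (n : ℕ) : MvPolynomial (Fin n) K →ₐ[K]
    AddMonoidAlgebra K (Fin n → ℤ) ⊗[K] MvPolynomial (Fin n) K :=
  MvPolynomial.aeval fun i => gmCoord K n i ⊗ₜ MvPolynomial.X i

/-- The morphism `Spec A ×_K Spec B ⟶ Spec B` over `K` with comorphism `f : B → A ⊗ B`. -/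
def specActionMap (A B : Type u) [CommRing A] [Algebra K A] [CommRing B] [Algebra K B]
    (f : B →ₐ[K] A ⊗[K] B) :
    (Spec (.of A)).asOver (Spec (.of K)) ⊗ (Spec (.of B)).asOver (Spec (.of K)) ⟶
      (Spec (.of B)).asOver (Spec (.of K)) :=
  Over.homMk ((pullbackSpecIso K A B).hom ≫ Spec.map (CommRingCat.ofHom f.toRingHom)) (by
    change ((pullbackSpecIso K A B).hom ≫ Spec.map _) ≫ Spec.map _ =
      pullback.fst (Spec.map _) (Spec.map _) ≫ Spec.map _
    rw [Category.assoc, ← Spec.map_comp, ← CommRingCat.ofHom_comp, ← Iso.eq_inv_comp,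
      pullbackSpecIso_inv_fst_assoc, ← Spec.map_comp, ← CommRingCat.ofHom_comp]
    congr 2
    exact f.comp_algebraMap)

/-- The natural action of `𝔾_m^n` on `𝔸^n` by coordinatewise multiplication. -/
def gmAction (n : ℕ) : Gm K n ⊗ affineSp K n ⟶ affineSp K n :=
  specActionMap K _ _ (gmCoaction K n)

variable {K}

/-- The character `χ^m`, as a regular function on the torus `Spec K[M]`. -/
def character {M : Type u} [AddCommGroup M] (m : M) : Γ((splitTorus K M).left, ⊤) :=
  (Scheme.ΓSpecIso (.of (AddMonoidAlgebra K M))).inv (AddMonoidAlgebra.single m 1)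

/-- `f ∈ K[X]` is semi-invariant of weight `m` for the action `a` of `Spec K[M]` on `X`:
`a^♯(f) = χ^m ⊗ f`, an equality of functions on `Spec K[M] × X`. -/
def IsSemiInvariant {M : Type u} [AddCommGroup M] {X : Over (Spec (.of K))}
    (a : splitTorus K M ⊗ X ⟶ X) (m : M) (f : Γ(X.left, ⊤)) : Prop :=
  a.left.appTop f =
    (fst (splitTorus K M) X).left.appTop (character m) *
      (snd (splitTorus K M) X).left.appTop f

/-- The weight cone of a torus action: the cone of `M_ℚ = ℚ ⊗ M` spanned by the weights, i.e. by
those `m ∈ M` with a non-zero semi-invariant function of weight `m`. -/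
def weightCone {M : Type u} [AddCommGroup M] {X : Over (Spec (.of K))}
    (a : splitTorus K M ⊗ X ⟶ X) : PointedCone ℚ (ℚ ⊗[ℤ] M) :=
  PointedCone.hull ℚ {v | ∃ m : M, (∃ f, IsSemiInvariant a m f ∧ f ≠ 0) ∧ v = 1 ⊗ₜ[ℤ] m}

/-- The action of a torus on `𝔸^n` obtained by restricting the natural action of `𝔾_m^n` along
a homomorphism `j`. -/
def restrictedAction {T : Over (Spec (.of K))} {n : ℕ} (j : T ⟶ Gm K n) :
    T ⊗ affineSp K n ⟶ affineSp K n :=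
  (j ▷ affineSp K n) ≫ gmAction K n

end Torus

end GaloisTorus

end

/-! An action of `T = Spec k'[M]` on an affine `X` is the same as an `M`-grading of `k'[X]`: the
expansion `a^♯ f = ∑ χ^m ⊗ f_m` is unique, the unit axiom gives `f = ∑ f_m`, and associativity makes
each `f_m` semi-invariant of weight `m` (`exists_sum_isSemiInvariant`). A `k`-group structure on `T`
preserves group-like functions, and these are the characters, so `Γ` acts on `M` and carries
semi-invariants to semi-invariants of the transported weight (`ActsOver.isSemiInvariant`).

By continuity every function on `X` is fixed by an open subgroup of `Γ`, so its orbit is finite.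
Take finitely many generators of `k'[X]`, replace them by their homogeneous components, and close up
under `Γ`. The result is a finite list of nonzero semi-invariant generators `f_i`, of weights `w_i`,
permuted by `Γ` through a finite quotient (`exists_equivariant_generators`). Permuting coordinates
in the same way defines `k`-structures on `𝔾_m^n` and `𝔸^n`. The `f_i` embed `X` in `𝔸^n`,
compatibly with these structures and equivariantly for the homomorphism `T → 𝔾_m^n` dual to `e_i ↦
w_i`.

If the weights of `X` lay in a proper subgroup `N` of `M`, the nontrivial subgroup `Spec k'[M/N]` of
`T` would act trivially. Hence effectiveness makes `ℤ^n → M` surjective, which gives both the closed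
immersion of `T` and `d ≤ n`. As the `f_i` are nonzero on an integral scheme, the generic point of
`X` lands in `𝔾_m^n`. Both weight cones are spanned by the `w_i` (`weightCone_eq_hull`). -/

noncomputable section

namespace GaloisTorus

/-! ### Morphisms to affine schemes and their effect on global functions -/

section SpecFunctions

/-- The ring homomorphism `R → Γ(Z)` attached to a morphism `Z ⟶ Spec R`. -/
def comorphism {R : Type u} [CommRing R] {Z : Scheme.{u}} (f : Z ⟶ Spec (.of R)) :
    R →+* Γ(Z, ⊤) :=
  ((Scheme.ΓSpecIso (.of R)).inv ≫ f.appTop).hom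

/-- An element of `R` as a regular function on `Spec R`. -/
def specFun (R : Type u) [CommRing R] : R →+* Γ(Spec (.of R), ⊤) :=
  (Scheme.ΓSpecIso (.of R)).inv.hom

lemma comorphism_apply {R : Type u} [CommRing R] {Z : Scheme.{u}} (f : Z ⟶ Spec (.of R)) (r : R) :
    comorphism f r = f.appTop (specFun R r) := rfl

lemma comorphism_injective {R : Type u} [CommRing R] {Z : Scheme.{u}} {f g : Z ⟶ Spec (.of R)}
    (h : comorphism f = comorphism g) : f = g :=
  ext_to_Spec (CommRingCat.hom_ext h)

lemma comp_comorphism {R : Type u} [CommRing R] {Z W : Scheme.{u}} (f : Z ⟶ W)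
    (g : W ⟶ Spec (.of R)) (r : R) :
    comorphism (f ≫ g) r = f.appTop (comorphism g r) := by
  simp only [comorphism, Scheme.Hom.comp_appTop]
  rfl

lemma appTop_comp_apply {X Y Z : Scheme.{u}} (f : X ⟶ Y) (g : Y ⟶ Z) (s : Γ(Z, ⊤)) :
    (f ≫ g).appTop s = f.appTop (g.appTop s) := by
  rw [Scheme.Hom.comp_appTop]
  rfl

lemma specMap_appTop {R S : Type u} [CommRing R] [CommRing S] (φ : R →+* S) (r : R) :
    (Spec.map (CommRingCat.ofHom φ)).appTop (specFun R r) = specFun S (φ r) := by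
  have := Scheme.ΓSpecIso_inv_naturality (CommRingCat.ofHom φ)
  exact (congr($(this).hom r)).symm

lemma specFun_bijective (R : Type u) [CommRing R] : Function.Bijective (specFun R) :=
  ConcreteCategory.bijective_of_isIso (Scheme.ΓSpecIso (.of R)).inv

lemma toSpecΓ_appTop_specFun {Z : Scheme.{u}} (s : Γ(Z, ⊤)) :
    Z.toSpecΓ.appTop (specFun Γ(Z, ⊤) s) = s := by
  have := (Scheme.ΓSpecIso Γ(Z, ⊤)).inv_hom_id
  exact (congr($(Scheme.toSpecΓ_appTop Z).hom (specFun _ s))).trans (congr($(this).hom s))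

/-- The morphism `Z ⟶ Spec R` with a given comorphism. -/
def toSpec {R : Type u} [CommRing R] {Z : Scheme.{u}} (φ : R →+* Γ(Z, ⊤)) : Z ⟶ Spec (.of R) :=
  Z.toSpecΓ ≫ Spec.map (CommRingCat.ofHom φ)

lemma comorphism_toSpec {R : Type u} [CommRing R] {Z : Scheme.{u}} (φ : R →+* Γ(Z, ⊤)) :
    comorphism (toSpec φ) = φ := by
  ext r
  rw [toSpec, comp_comorphism, comorphism_apply, specMap_appTop]
  exact toSpecΓ_appTop_specFun _

variable {K : Type u} [Field K]

/-- The constant functions on a scheme over `K`. -/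
def scalar (X : Over (Spec (.of K))) : K →+* Γ(X.left, ⊤) := comorphism X.hom

lemma appTop_scalar {X Y : Over (Spec (.of K))} (f : X ⟶ Y) (c : K) :
    f.left.appTop (scalar Y c) = scalar X c := by
  rw [scalar, scalar, ← comp_comorphism, Over.w]

lemma scalar_spec (R : Type u) [CommRing R] [Algebra K R] (c : K) :
    scalar ((Spec (.of R)).asOver (Spec (.of K))) c = specFun R (algebraMap K R c) :=
  specMap_appTop _ _

lemma over_hom_ext_of_isAffine {X Y : Over (Spec (.of K))} [IsAffine Y.left] {f g : X ⟶ Y}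
    (h : ∀ s, f.left.appTop s = g.left.appTop s) : f = g := by
  ext1
  apply ext_of_isAffine
  ext s
  exact h s

lemma isAffine_tensor (X Y : Over (Spec (.of K))) [IsAffine X.left] [IsAffine Y.left] :
    IsAffine (X ⊗ Y).left :=
  inferInstanceAs (IsAffine (pullback X.hom Y.hom))

end SpecFunctions

/-! ### Group-like elements of a bialgebra as functions on its spectrum -/

section GroupLike

variable {K : Type u} [Field K] {R : Type u} [CommRing R]

lemma pullbackSpecIso_hom_appTop_tmul (S : Type u) [CommRing S] [Algebra K R] [Algebra K S]
    (r : R) (s : S) :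
    (pullbackSpecIso K R S).hom.appTop (specFun (R ⊗[K] S) (r ⊗ₜ s)) =
      (fst ((Spec (.of R)).asOver (Spec (.of K)))
        ((Spec (.of S)).asOver (Spec (.of K)))).left.appTop (specFun R r) *
      (snd ((Spec (.of R)).asOver (Spec (.of K)))
        ((Spec (.of S)).asOver (Spec (.of K)))).left.appTop (specFun S s) := by
  have h : r ⊗ₜ[K] s = (Algebra.TensorProduct.includeLeftRingHom : R →+* R ⊗[K] S) r *
      (Algebra.TensorProduct.includeRight : S →ₐ[K] R ⊗[K] S).toRingHom s := by simp
  rw [h, map_mul, map_mul, ← specMap_appTop, ← specMap_appTop, ← appTop_comp_apply,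
    ← appTop_comp_apply]
  congr 1
  · exact congr(($(pullbackSpecIso_hom_fst K R S)).appTop (specFun R r))
  · exact congr(($(pullbackSpecIso_hom_snd K R S)).appTop (specFun S s))

lemma mul_appTop_of_comul [Bialgebra K R] {g : R} (hg : Coalgebra.comul (R := K) g = g ⊗ₜ[K] g) :
    (MonObj.mul (X := (Spec (.of R)).asOver (Spec (.of K)))).left.appTop (specFun R g) =
      (fst ((Spec (.of R)).asOver (Spec (.of K)))
        ((Spec (.of R)).asOver (Spec (.of K)))).left.appTop (specFun R g) *
      (snd ((Spec (.of R)).asOver (Spec (.of K)))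
        ((Spec (.of R)).asOver (Spec (.of K)))).left.appTop (specFun R g) := by
  rw [← pullbackSpecIso_hom_appTop_tmul, ← hg]
  refine (appTop_comp_apply (pullbackSpecIso K R R).hom
    (Spec.map (CommRingCat.ofHom (Bialgebra.comulAlgHom K R).toRingHom)) (specFun R g)).trans ?_
  rw [specMap_appTop]
  rfl

lemma one_appTop_of_counit [Bialgebra K R] {g : R} (hg : Coalgebra.counit (R := K) g = 1) :
    (MonObj.one (X := (Spec (.of R)).asOver (Spec (.of K)))).left.appTop (specFun R g) = 1 := by
  refine (specMap_appTop (Bialgebra.counitAlgHom K R).toRingHom g).trans ?_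
  have : (Bialgebra.counitAlgHom K R).toRingHom g = 1 := hg
  rw [this, map_one]

end GroupLike

/-! ### Functions on `T × X` as sums `∑ χ^m ⊗ f_m` -/

section ProductDecomposition

variable {K : Type u} [Field K] {M : Type u} [AddCommGroup M]

lemma character_eq_specFun (m : M) :
    character (K := K) m = specFun (AddMonoidAlgebra K M) (AddMonoidAlgebra.single m 1) := rfl

lemma character_add (m m' : M) :
    character (K := K) (m + m') = character m * character m' := by
  rw [character_eq_specFun, character_eq_specFun, character_eq_specFun]
  refine Eq.trans ?_ (map_mul (specFun (AddMonoidAlgebra K M)) _ _)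
  rw [AddMonoidAlgebra.single_mul_single, mul_one]

lemma character_zero : character (K := K) (0 : M) = 1 :=
  map_one (specFun (AddMonoidAlgebra K M))

/-- The function `χ^m ⊗ f` on the product of a split torus with `X`. -/
def charMul {X : Over (Spec (.of K))} (m : M) (f : Γ(X.left, ⊤)) :
    Γ((splitTorus K M ⊗ X).left, ⊤) :=
  (fst (splitTorus K M) X).left.appTop (character m) * (snd (splitTorus K M) X).left.appTop f

lemma charMul_add {X : Over (Spec (.of K))} (m : M) (f g : Γ(X.left, ⊤)) :
    charMul (K := K) m (f + g) = charMul m f + charMul m g := by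
  simp only [charMul, map_add, mul_add]

lemma charMul_mul {X : Over (Spec (.of K))} (m m' : M) (f g : Γ(X.left, ⊤)) :
    charMul (K := K) (m + m') (f * g) = charMul m f * charMul m' g := by
  simp only [charMul, character_add, map_mul]
  ring

lemma charMul_zero {X : Over (Spec (.of K))} (m : M) :
    charMul (K := K) m (0 : Γ(X.left, ⊤)) = 0 := by
  simp only [charMul, map_zero, mul_zero]

-- For `A = K[X]` one has `K[M] ⊗ A = A[M]`, so `T × X` is `Spec A[M]` and a function on it is a
-- finitely supported family of elements of `A`. Existence and uniqueness of expansions are the two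
-- halves of bijectivity.
open scoped AlgebraMonoidAlgebra in
lemma exists_charMul_equiv (X : Over (Spec (.of K))) [IsAffine X.left] :
    ∃ e : AddMonoidAlgebra Γ(X.left, ⊤) M → Γ((splitTorus K M ⊗ X).left, ⊤),
      Function.Bijective e ∧
      ∀ c, e c = c.coeff.sum fun m f => charMul m f := by
  let A : Type u := Γ(X.left, ⊤)
  let : CommRing A := inferInstanceAs (CommRing Γ(X.left, ⊤))
  let : Algebra K A := (scalar X).toAlgebra
  have sq := isPullback_SpecMap_of_isPushout _ _ _ _
    (CommRingCat.isPushout_of_isPushout K (AddMonoidAlgebra K M) A (AddMonoidAlgebra A M))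
  have hX : X.left.isoSpec.hom ≫ Spec.map (CommRingCat.ofHom (algebraMap K A)) = X.hom := by
    apply comorphism_injective
    exact comorphism_toSpec (scalar X)
  have sq' : IsPullback (Spec.map (CommRingCat.ofHom
      (algebraMap (AddMonoidAlgebra K M) (AddMonoidAlgebra A M))))
      (Spec.map (CommRingCat.ofHom (algebraMap A (AddMonoidAlgebra A M))) ≫ X.left.isoSpec.inv)
      (splitTorus K M).hom X.hom := by
    refine sq.of_iso (Iso.refl _) (Iso.refl _) X.left.isoSpec.symm (Iso.refl _) ?_ ?_ ?_ ?_
    · simp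
    · simp
    · simp; rfl
    · simp [← hX]
  let θ : (splitTorus K M ⊗ X).left ⟶ Spec (.of (AddMonoidAlgebra A M)) :=
    (sq'.isoIsPullback _ _ (IsPullback.of_hasPullback _ _)).inv
  have h₁ : θ ≫ Spec.map (CommRingCat.ofHom
      (algebraMap (AddMonoidAlgebra K M) (AddMonoidAlgebra A M))) =
      (fst (splitTorus K M) X).left :=
    sq'.isoIsPullback_inv_fst _ _ _
  have h₂ : θ ≫ Spec.map (CommRingCat.ofHom (algebraMap A (AddMonoidAlgebra A M))) =
      (snd (splitTorus K M) X).left ≫ X.left.isoSpec.hom := by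
    rw [← Iso.comp_inv_eq, Category.assoc]
    exact sq'.isoIsPullback_inv_snd _ _ _
  have h₃ (f : A) : X.left.isoSpec.hom.appTop (specFun A f) = f :=
    toSpecΓ_appTop_specFun f
  refine ⟨comorphism θ, ?_, fun c => ?_⟩
  · have : IsIso θ := inferInstanceAs (IsIso (sq'.isoIsPullback _ _ _).inv)
    have : IsIso θ.appTop := inferInstanceAs (IsIso (Scheme.Γ.map θ.op))
    exact (ConcreteCategory.bijective_of_isIso θ.appTop).comp (specFun_bijective _)
  · have key (m : M) (f : A) : comorphism θ (AddMonoidAlgebra.single m f) = charMul m f := by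
      have : AddMonoidAlgebra.single m f =
          algebraMap (AddMonoidAlgebra K M) (AddMonoidAlgebra A M) (AddMonoidAlgebra.single m 1) *
            algebraMap A (AddMonoidAlgebra A M) f := by
        simp [AddMonoidAlgebra.single_mul_single]
      rw [this, map_mul, comorphism_apply, comorphism_apply, ← specMap_appTop, ← specMap_appTop,
        ← appTop_comp_apply, ← appTop_comp_apply, h₁, h₂, appTop_comp_apply, h₃]
      rfl
    conv_lhs => rw [← AddMonoidAlgebra.sum_coeff_single c]
    rw [Finsupp.sum, map_sum]
    exact Finset.sum_congr rfl fun m _ => key m _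

/-- Every function on `T × X` is a finite sum `∑ χ^m ⊗ f_m`. -/
lemma exists_charMul_sum {X : Over (Spec (.of K))} [IsAffine X.left]
    (h : Γ((splitTorus K M ⊗ X).left, ⊤)) :
    ∃ c : M →₀ Γ(X.left, ⊤), h = c.sum fun m f => charMul m f := by
  obtain ⟨e, he, hc⟩ := exists_charMul_equiv (M := M) X
  obtain ⟨c, rfl⟩ := he.2 h
  exact ⟨c.coeff, hc c⟩

/-- The coefficients `f_m` in `∑ χ^m ⊗ f_m` are unique. -/
lemma charMul_sum_injective {X : Over (Spec (.of K))} [IsAffine X.left]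
    {c c' : M →₀ Γ(X.left, ⊤)}
    (h : (c.sum fun m f => charMul (K := K) m f) = c'.sum fun m f => charMul m f) : c = c' := by
  obtain ⟨e, he, hc⟩ := exists_charMul_equiv (M := M) X
  have := he.1 ((hc (.ofCoeff c)).trans (h.trans (hc (.ofCoeff c')).symm))
  exact congr(($this).coeff)

end ProductDecomposition
-- Semi-invariant functions and the weight cone
section SemiInvariants

variable {K : Type u} [Field K] {M : Type u} [AddCommGroup M] {X : Over (Spec (.of K))}
  {a : splitTorus K M ⊗ X ⟶ X}

lemma isSemiInvariant_iff {m : M} {f : Γ(X.left, ⊤)} :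
    IsSemiInvariant a m f ↔ a.left.appTop f = charMul m f := Iff.rfl

lemma IsSemiInvariant.mul {m m' : M} {f g : Γ(X.left, ⊤)} (hf : IsSemiInvariant a m f)
    (hg : IsSemiInvariant a m' g) : IsSemiInvariant a (m + m') (f * g) := by
  rw [isSemiInvariant_iff] at *
  rw [map_mul, hf, hg, charMul_mul]

lemma charMul_zero_scalar (c : K) :
    charMul (0 : M) (scalar X c) = scalar (splitTorus K M ⊗ X) c := by
  rw [charMul, character_zero, map_one, one_mul, appTop_scalar]

lemma isSemiInvariant_scalar (c : K) : IsSemiInvariant a 0 (scalar X c) := by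
  rw [isSemiInvariant_iff, appTop_scalar, charMul_zero_scalar]

lemma isSemiInvariant_one : IsSemiInvariant a 0 1 := by
  simpa using isSemiInvariant_scalar (a := a) 1

lemma IsSemiInvariant.pow {m : M} {f : Γ(X.left, ⊤)} (hf : IsSemiInvariant a m f) (n : ℕ) :
    IsSemiInvariant a (n • m) (f ^ n) := by
  induction n with
  | zero => simpa using isSemiInvariant_one
  | succ n ih => rw [pow_succ, succ_nsmul]; exact ih.mul hf

lemma IsSemiInvariant.prod {ι : Type*} (s : Finset ι) {w : ι → M} {f : ι → Γ(X.left, ⊤)}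
    (hf : ∀ i, IsSemiInvariant a (w i) (f i)) :
    IsSemiInvariant a (∑ i ∈ s, w i) (∏ i ∈ s, f i) := by
  classical
  induction s using Finset.induction_on with
  | empty => simpa using isSemiInvariant_one
  | insert i s hi ih => rw [Finset.sum_insert hi, Finset.prod_insert hi]; exact (hf i).mul ih

instance isAffine_splitTorus_left : IsAffine (splitTorus K M).left :=
  inferInstanceAs (IsAffine (Spec _))

variable [IsAffine X.left]

lemma charMul_injective {m m' : M} {f f' : Γ(X.left, ⊤)} (hf : f ≠ 0)
    (h : charMul (K := K) m f = charMul m' f') : m = m' ∧ f = f' := by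
  have := charMul_sum_injective (K := K) (c := Finsupp.single m f) (c' := Finsupp.single m' f') (by
    rw [Finsupp.sum_single_index (charMul_zero _), Finsupp.sum_single_index (charMul_zero _), h])
  rcases Finsupp.single_eq_single_iff .. |>.1 this with h | h
  · exact h
  · exact absurd h.1 hf

lemma IsSemiInvariant.weight_unique {m m' : M} {f : Γ(X.left, ⊤)} (hf : IsSemiInvariant a m f)
    (hf' : IsSemiInvariant a m' f) (h0 : f ≠ 0) : m = m' :=
  (charMul_injective h0 (hf.symm.trans hf')).1

/-- If the algebra of functions is generated by semi-invariants of weights `w i`, then every weight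
lies in the monoid generated by the `w i`. -/
lemma IsSemiInvariant.weight_mem_closure {n : ℕ} {w : Fin n → M} {f : Fin n → Γ(X.left, ⊤)}
    (hf : ∀ i, IsSemiInvariant a (w i) (f i))
    (hgen : Function.Surjective (MvPolynomial.eval₂Hom (scalar X) f))
    {m : M} {g : Γ(X.left, ⊤)} (hg : IsSemiInvariant a m g) (h0 : g ≠ 0) :
    m ∈ AddSubmonoid.closure (Set.range w) := by
  classical
  obtain ⟨p, rfl⟩ := hgen g
  let W : (Fin n →₀ ℕ) → M := fun s => ∑ i, s i • w i
  let F : (Fin n →₀ ℕ) → Γ(X.left, ⊤) := fun s => scalar X (p.coeff s) * ∏ i, f i ^ s i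
  have hF (s : Fin n →₀ ℕ) : IsSemiInvariant a (W s) (F s) := by
    have := (isSemiInvariant_scalar (a := a) (p.coeff s)).mul
      (IsSemiInvariant.prod Finset.univ fun i => (hf i).pow (s i))
    rwa [zero_add] at this
  have hp : MvPolynomial.eval₂Hom (scalar X) f p = ∑ s ∈ p.support, F s :=
    MvPolynomial.eval₂_eq' _ _ _
  -- Expanding `a^♯ g` as `χ^m ⊗ g` and, monomial by monomial, as `∑ χ^{W s} ⊗ F s` gives the same
  -- coefficients. At `m` the coefficient `g` is nonzero, so some monomial has weight exactly `m`.
  have key : Finsupp.single m (MvPolynomial.eval₂Hom (scalar X) f p) =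
      ∑ s ∈ p.support, Finsupp.single (W s) (F s) := by
    apply charMul_sum_injective (K := K)
    rw [Finsupp.sum_single_index (charMul_zero _), ← isSemiInvariant_iff.1 hg, hp, map_sum,
      ← Finsupp.sum_finsetSum_index charMul_zero charMul_add]
    refine Finset.sum_congr rfl fun s _ => ?_
    rw [Finsupp.sum_single_index (charMul_zero _)]
    exact hF s
  have h1 : (∑ s ∈ p.support, Finsupp.single (W s) (F s)) m ≠ 0 := by
    rw [← key, Finsupp.single_eq_same]
    exact h0
  rw [Finsupp.finsetSum_apply] at h1
  obtain ⟨s, -, hs⟩ := Finset.exists_ne_zero_of_sum_ne_zero h1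
  have : W s = m := by
    by_contra h
    exact hs (Finsupp.single_eq_of_ne (Ne.symm h))
  rw [← this]
  exact sum_mem fun i _ => nsmul_mem (AddSubmonoid.subset_closure (Set.mem_range_self i)) _

/-- Expresses the cone through the weights of any generating family of nonzero semi-invariants. It
applies to `X` and to `𝔸^n` with the same weights, whence the equality of cones. -/
lemma weightCone_eq_hull {n : ℕ} {w : Fin n → M} {f : Fin n → Γ(X.left, ⊤)}
    (hf : ∀ i, IsSemiInvariant a (w i) (f i)) (h0 : ∀ i, f i ≠ 0)
    (hgen : Function.Surjective (MvPolynomial.eval₂Hom (scalar X) f)) :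
    weightCone a = PointedCone.hull ℚ (Set.range fun i => (1 : ℚ) ⊗ₜ[ℤ] w i) := by
  apply le_antisymm
  · refine Submodule.span_le.2 ?_
    rintro _ ⟨m, ⟨g, hg, hg0⟩, rfl⟩
    have := hg.weight_mem_closure hf hgen hg0
    clear hg
    induction this using AddSubmonoid.closure_induction with
    | mem x hx =>
      obtain ⟨i, rfl⟩ := hx
      exact Submodule.subset_span ⟨i, rfl⟩
    | zero => rw [TensorProduct.tmul_zero]; exact zero_mem _
    | add x y _ _ hx hy => rw [TensorProduct.tmul_add]; exact add_mem hx hy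
  · refine Submodule.span_le.2 ?_
    rintro _ ⟨i, rfl⟩
    exact Submodule.subset_span ⟨w i, ⟨f i, hf i, h0 i⟩, rfl⟩

end SemiInvariants

/-! ### Torus actions as gradings, and effectiveness -/

section TorusGroup

variable {K : Type u} [Field K] {M : Type u} [AddCommGroup M]

lemma mul_appTop_character (m : M) :
    (MonObj.mul (X := splitTorus K M)).left.appTop (character m) =
      charMul m (character m) :=
  mul_appTop_of_comul (by simp)

lemma one_appTop_character (m : M) :
    (MonObj.one (X := splitTorus K M)).left.appTop (character m) = 1 :=
  one_appTop_of_counit (by simp)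

variable {X : Over (Spec (.of K))}

lemma whiskerLeft_appTop_charMul {Y : Over (Spec (.of K))} (g : X ⟶ Y) (m : M) (f : Γ(Y.left, ⊤)) :
    (splitTorus K M ◁ g).left.appTop (charMul m f) = charMul m (g.left.appTop f) := by
  rw [charMul, map_mul, ← appTop_comp_apply, ← appTop_comp_apply, ← Over.comp_left,
    ← Over.comp_left, whiskerLeft_fst, whiskerLeft_snd, Over.comp_left, appTop_comp_apply]
  rfl

lemma whiskerRight_appTop_charMul {S : Over (Spec (.of K))} (t : S ⟶ splitTorus K M) (m : M)
    (f : Γ(X.left, ⊤)) :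
    (t ▷ X).left.appTop (charMul m f) =
      (fst S X).left.appTop (t.left.appTop (character m)) * (snd S X).left.appTop f := by
  rw [charMul, map_mul, ← appTop_comp_apply, ← appTop_comp_apply, ← Over.comp_left,
    ← Over.comp_left, whiskerRight_fst, whiskerRight_snd, Over.comp_left, appTop_comp_apply]

variable [ModObj (splitTorus K M) X]

/-- The sum of the weight components of a function is the function. -/
lemma sum_eq_of_smul_appTop_eq {f : Γ(X.left, ⊤)} {c : M →₀ Γ(X.left, ⊤)}
    (h : (ModObj.smul (M := splitTorus K M) (X := X)).left.appTop f =
      c.sum fun m g => charMul m g) : f = c.sum fun _ g => g := by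
  -- Restricting the expansion along the unit section sends every `χ^m` to `1`.
  have h1 : (λ_ X).inv ≫ (MonObj.one (X := splitTorus K M) ▷ X) ≫
      ModObj.smul (M := splitTorus K M) (X := X) = 𝟙 X := by
    rw [Iso.inv_comp_eq, Category.comp_id]
    exact ModObj.one_smul (M := splitTorus K M) X
  have h2 := congr(($h1).left.appTop f)
  rw [Over.comp_left, Over.comp_left, appTop_comp_apply, appTop_comp_apply, h, Finsupp.sum,
    map_sum, map_sum] at h2
  refine Eq.trans h2.symm (Finset.sum_congr rfl fun m _ => ?_)
  rw [whiskerRight_appTop_charMul, one_appTop_character, map_one, one_mul, ← appTop_comp_apply,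
    ← Over.comp_left, leftUnitor_inv_snd]
  rfl

/-- The weight components of a function are semi-invariant. -/
lemma isSemiInvariant_of_smul_appTop_eq [IsAffine X.left] {f : Γ(X.left, ⊤)}
    {c : M →₀ Γ(X.left, ⊤)}
    (h : (ModObj.smul (M := splitTorus K M) (X := X)).left.appTop f =
      c.sum fun m g => charMul m g) (m : M) :
    IsSemiInvariant (ModObj.smul (M := splitTorus K M) (X := X)) m (c m) := by
  let a : splitTorus K M ⊗ X ⟶ X := ModObj.smul (M := splitTorus K M) (X := X)
  have : IsAffine (splitTorus K M ⊗ X).left := isAffine_tensor _ X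
  -- Associativity on `f` reads `∑ χ^m ⊗ a^♯ c_m = ∑ χ^m ⊗ (χ^m ⊗ c_m)`. Comparing the coefficients
  -- of `χ^m` over `T × X` gives the semi-invariance of `c_m`.
  have h1 : (splitTorus K M ◁ a) ≫ a =
      (α_ _ _ X).inv ≫ (MonObj.mul (X := splitTorus K M) ▷ X) ≫ a :=
    ModObj.assoc_flip (M := splitTorus K M) X
  have h2 := congr(($h1).left.appTop f)
  rw [Over.comp_left, Over.comp_left, Over.comp_left, appTop_comp_apply, appTop_comp_apply,
    appTop_comp_apply, h, Finsupp.sum, map_sum, map_sum, map_sum] at h2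
  have h3 (m : M) (g : Γ(X.left, ⊤)) :
      (α_ (splitTorus K M) (splitTorus K M) X).inv.left.appTop
        ((MonObj.mul (X := splitTorus K M) ▷ X).left.appTop (charMul m g)) =
      charMul m (charMul (K := K) m g) := by
    rw [whiskerRight_appTop_charMul, mul_appTop_character]
    simp only [charMul, map_mul, ← appTop_comp_apply, ← Over.comp_left]
    rw [associator_inv_fst_fst, associator_inv_fst_snd, associator_inv_snd, mul_assoc]
  have h4 := charMul_sum_injective (K := K) (c := c.mapRange a.left.appTop (map_zero _))
    (c' := Finsupp.onFinset c.support (fun m => charMul m (c m)) fun m hm => by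
      rw [Finsupp.mem_support_iff]
      rintro h0
      rw [h0, charMul_zero] at hm
      exact hm rfl) (by
    rw [Finsupp.sum_mapRange_index charMul_zero, Finsupp.onFinset_sum _ charMul_zero]
    refine Eq.trans (Finset.sum_congr rfl fun m _ => ?_)
      (h2.trans (Finset.sum_congr rfl fun m _ => h3 m _))
    exact (whiskerLeft_appTop_charMul a m (c m)).symm)
  exact congr($h4 m)

lemma exists_sum_isSemiInvariant [IsAffine X.left] (f : Γ(X.left, ⊤)) :
    ∃ c : M →₀ Γ(X.left, ⊤), f = (c.sum fun _ g => g) ∧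
      ∀ m, IsSemiInvariant (ModObj.smul (M := splitTorus K M) (X := X)) m (c m) := by
  obtain ⟨c, hc⟩ := exists_charMul_sum
    ((ModObj.smul (M := splitTorus K M) (X := X)).left.appTop f)
  exact ⟨c, sum_eq_of_smul_appTop_eq hc, isSemiInvariant_of_smul_appTop_eq hc⟩

/-- The weights of an effective torus action on an affine scheme generate the character lattice. -/
lemma IsEffective.closure_weights_eq_top [IsAffine X.left]
    (heff : IsEffective (ModObj.smul (M := splitTorus K M) (X := X))) (N : AddSubgroup M)
    (hN : ∀ (m : M) (f : Γ(X.left, ⊤)),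
      IsSemiInvariant (ModObj.smul (M := splitTorus K M) (X := X)) m f → f ≠ 0 → m ∈ N) :
    N = ⊤ := by
  -- The test point is the subgroup `Spec K[M/N]` of `T`, on which every character in `N` is
  -- trivial.
  let π := AddMonoidAlgebra.mapDomainAlgHom K K (QuotientAddGroup.mk' N)
  let t : splitTorus K (M ⧸ N) ⟶ splitTorus K M :=
    Scheme.Hom.asOver (Spec.map (CommRingCat.ofHom π.toRingHom)) (Spec (.of K))
  have ht (m : M) : t.left.appTop (character m) = character (K := K) (m : M ⧸ N) := by
    refine (specMap_appTop π.toRingHom (AddMonoidAlgebra.single m 1)).trans ?_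
    rw [character_eq_specFun]
    congr 1
    exact AddMonoidAlgebra.mapDomain_single
  have htriv : (t ▷ X) ≫ ModObj.smul (M := splitTorus K M) (X := X) = snd _ X := by
    apply over_hom_ext_of_isAffine
    intro f
    obtain ⟨c, rfl, hc⟩ := exists_sum_isSemiInvariant (K := K) (M := M) f
    rw [Finsupp.sum, map_sum, map_sum]
    refine Finset.sum_congr rfl fun m hm => ?_
    have hmN : m ∈ N := hN m (c m) (hc m) (Finsupp.mem_support_iff.1 hm)
    rw [Over.comp_left, appTop_comp_apply, isSemiInvariant_iff.1 (hc m),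
      whiskerRight_appTop_charMul, ht, (QuotientAddGroup.eq_zero_iff m).2 hmN, character_zero,
      map_one, one_mul]
  have h := heff _ t htriv
  rw [eq_top_iff]
  intro m _
  have h1 := congr(($h).left.appTop (character m))
  rw [ht, Over.comp_left, appTop_comp_apply, one_appTop_character, map_one] at h1
  have h2 := (specFun_bijective _).1 (h1.trans (map_one (specFun _)).symm)
  -- By effectiveness `χ^m` restricts to `1` on this subgroup; the coefficient at the class of `m`
  -- distinguishes the two unless that class is zero.
  have h3 := congr(($h2).coeff (m : M ⧸ N))
  rw [AddMonoidAlgebra.one_def] at h3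
  by_contra hm
  rw [← QuotientAddGroup.eq_zero_iff] at hm
  simp [Finsupp.single_eq_of_ne hm] at h3

end TorusGroup
-- Both legs factor through `S`, and the induced map `P → S` followed by the inclusion is the
-- identity by uniqueness.
lemma _root_.CommRingCat.mem_of_isPushout {A B C P : CommRingCat.{u}} {f : A ⟶ B} {g : A ⟶ C}
    {inl : B ⟶ P} {inr : C ⟶ P} (h : IsPushout f g inl inr) (S : Subring P)
    (hl : ∀ b, inl b ∈ S) (hr : ∀ c, inr c ∈ S) (x : P) : x ∈ S := by
  let l : B ⟶ .of S := CommRingCat.ofHom (inl.hom.codRestrict S hl)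
  let r : C ⟶ .of S := CommRingCat.ofHom (inr.hom.codRestrict S hr)
  have hlr : f ≫ l = g ≫ r := by
    ext a : 2
    exact Subtype.ext (congr($(h.w) a))
  have : h.desc l r hlr ≫ CommRingCat.ofHom S.subtype = 𝟙 P := by
    apply h.hom_ext
    · rw [h.inl_desc_assoc]; rfl
    · rw [h.inr_desc_assoc]; rfl
  have hx := congr($this x)
  rw [← show _ = x from hx]
  exact (h.desc l r hlr x).2

/-! ### Open stabilizers and finite Galois orbits of functions -/

section SmoothVectors

variable {k k' : Type u} [Field k] [Field k'] [Algebra k k']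

lemma specGal_comorphism (γ : k' ≃ₐ[k] k') (c : k') :
    (specGal k γ).appTop (specFun k' c) = specFun k' (γ c) :=
  specMap_appTop _ _

variable [IsGalois k k']

/-- Functions on the base change to `k'` of an affine `K₁`-scheme are fixed by all semilinear
automorphisms over the `K₁`-scheme attached to elements of an open subgroup. -/
lemma exists_fixingSubgroup_of_isPullback {K₁ : IntermediateField k k'} {U V : Scheme.{u}}
    [IsAffine U] {q : V ⟶ U} {v : V ⟶ Spec (.of k')} {s : U ⟶ Spec (.of K₁)}
    (sq : IsPullback q v s (Spec.map (CommRingCat.ofHom (algebraMap K₁ k'))))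
    (h : Γ(V, ⊤)) :
    ∃ E : IntermediateField k k', FiniteDimensional k E ∧ ∀ γ ∈ E.fixingSubgroup,
      ∀ w : V ⟶ V, w ≫ q = q → w ≫ v = v ≫ specGal k γ → w.appTop h = h := by
  -- Composita of finite extensions make the functions with open stabilizer a subring. It contains
  -- the functions pulled back from `U`, fixed by every `w`, and the constants `c`, fixed over
  -- `k(c)`; these generate.
  let S : Subring Γ(V, ⊤) :=
    { carrier := {h | ∃ E : IntermediateField k k', FiniteDimensional k E ∧
        ∀ γ ∈ E.fixingSubgroup, ∀ w : V ⟶ V, w ≫ q = q → w ≫ v = v ≫ specGal k γ →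
          w.appTop h = h}
      mul_mem' := by
        rintro a b ⟨E, hE, ha⟩ ⟨F, hF, hb⟩
        refine ⟨E ⊔ F, inferInstance, fun γ hγ w hw hw' => ?_⟩
        rw [IntermediateField.fixingSubgroup_sup] at hγ
        rw [map_mul, ha γ hγ.1 w hw hw', hb γ hγ.2 w hw hw']
      one_mem' := ⟨⊥, inferInstance, fun γ _ w _ _ => map_one _⟩
      add_mem' := by
        rintro a b ⟨E, hE, ha⟩ ⟨F, hF, hb⟩
        refine ⟨E ⊔ F, inferInstance, fun γ hγ w hw hw' => ?_⟩
        rw [IntermediateField.fixingSubgroup_sup] at hγ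
        rw [map_add, ha γ hγ.1 w hw hw', hb γ hγ.2 w hw hw']
      zero_mem' := ⟨⊥, inferInstance, fun γ _ w _ _ => map_zero _⟩
      neg_mem' := by
        rintro a ⟨E, hE, ha⟩
        refine ⟨E, hE, fun γ hγ w hw hw' => ?_⟩
        rw [map_neg, ha γ hγ w hw hw'] }
  refine CommRingCat.mem_of_isPushout (isPushout_appTop_of_isPullback sq) S (fun b => ?_)
    (fun c => ?_) h
  · refine ⟨⊥, inferInstance, fun γ _ w hw _ => ?_⟩
    rw [← appTop_comp_apply, hw]
  · obtain ⟨c, rfl⟩ := (specFun_bijective k').2 c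
    refine ⟨IntermediateField.adjoin k {c}, IntermediateField.adjoin.finiteDimensional
      (Algebra.IsIntegral.isIntegral c), fun γ hγ w _ hw => ?_⟩
    rw [← appTop_comp_apply, hw, appTop_comp_apply, specGal_comorphism,
      (IntermediateField.mem_fixingSubgroup_iff _ _).1 hγ c
        (IntermediateField.mem_adjoin_simple_self k c)]

/-- Functions on a scheme with a `k`-structure have open stabilizers. -/
lemma KStructure.exists_fixingSubgroup {X : Over (Spec (.of k'))}
    (σ : KStructure k X) (f : Γ(X.left, ⊤)) :
    ∃ E : IntermediateField k k', FiniteDimensional k E ∧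
      ∀ γ ∈ E.fixingSubgroup, (σ.act γ).appTop f = f := by
  obtain ⟨K₁, hfin, -, X₁, hX₁, p, sq, hp⟩ := σ.continuous
  have := hX₁.quasiCompact
  have : CompactSpace X₁.left := QuasiCompact.compactSpace_of_compactSpace X₁.hom
  -- The form `X₁` is not assumed affine. A finite affine cover suffices, since only finitely many
  -- fields of definition then enter the compositum.
  let 𝒰 : X₁.left.OpenCover := Scheme.OpenCover.finiteSubcover X₁.left.affineCover
  have (i : 𝒰.I₀) : IsAffine (𝒰.X i) := inferInstance
  let j (i : 𝒰.I₀) : pullback p (𝒰.f i) ⟶ X.left := pullback.fst p (𝒰.f i)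
  let q (i : 𝒰.I₀) : pullback p (𝒰.f i) ⟶ 𝒰.X i := pullback.snd p (𝒰.f i)
  have hsq (i : 𝒰.I₀) : IsPullback (q i) (j i ≫ X.hom) (𝒰.f i ≫ X₁.hom)
      (Spec.map (CommRingCat.ofHom (algebraMap K₁ k'))) :=
    (IsPullback.of_hasPullback p (𝒰.f i)).flip.paste_vert sq
  choose E hE hfix using fun i => exists_fixingSubgroup_of_isPullback (hsq i) ((j i).appTop f)
  refine ⟨K₁ ⊔ ⨆ i, E i, inferInstance, fun γ hγ => ?_⟩
  rw [IntermediateField.fixingSubgroup_sup] at hγ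
  have hγp := hp γ hγ.1
  rw [← sub_eq_zero]
  refine Scheme.zero_of_zero_cover _ (Precoverage.ZeroHypercover.pullback₁ p 𝒰) fun i => ?_
  -- Since `p ∘ σ_γ = p`, the preimage of each chart is stable under `σ_γ`, which restricts to `w`.
  let w : pullback p (𝒰.f i) ⟶ pullback p (𝒰.f i) :=
    pullback.lift (j i ≫ σ.act γ) (q i) (by
      rw [Category.assoc, hγp]
      exact pullback.condition)
  have hwj : w ≫ j i = j i ≫ σ.act γ := pullback.lift_fst _ _ _
  have := hfix i γ (IntermediateField.fixingSubgroup_antitone (le_iSup E i) hγ.2) w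
    (pullback.lift_snd _ _ _) (by
      rw [← Category.assoc, hwj, Category.assoc, Category.assoc, σ.semilinear])
  rw [← appTop_comp_apply, hwj, appTop_comp_apply] at this
  rw [map_sub, sub_eq_zero]
  exact this

lemma finiteIndex_fixingSubgroup (E : IntermediateField k k') [FiniteDimensional k E] :
    E.fixingSubgroup.FiniteIndex :=
  ⟨by rw [← IntermediateField.finrank_eq_fixingSubgroup_index]; exact Module.finrank_pos.ne'⟩

/-- The action of the Galois group on functions given by a `k`-structure. -/
abbrev KStructure.mulAction {X : Over (Spec (.of k'))} (σ : KStructure k X) :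
    MulAction (k' ≃ₐ[k] k') Γ(X.left, ⊤) where
  smul γ f := (σ.act γ).appTop f
  one_smul f := by
    change (σ.act 1).appTop f = f
    rw [σ.act_one]
    simp
  mul_smul γ γ' f := by
    change (σ.act (γ * γ')).appTop f = (σ.act γ).appTop ((σ.act γ').appTop f)
    rw [σ.act_mul, appTop_comp_apply]

/-- Finitely many functions are contained in a finite Galois-stable set of functions, on which the
Galois group acts through a finite quotient. -/
lemma KStructure.exists_permutation {X : Over (Spec (.of k'))} (σ : KStructure k X)
    (s : Set Γ(X.left, ⊤)) (hs : s.Finite) (P : Γ(X.left, ⊤) → Prop) (hP : ∀ f ∈ s, P f)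
    (hPσ : ∀ γ f, P f → P ((σ.act γ).appTop f)) :
    ∃ (n : ℕ) (f : Fin n → Γ(X.left, ⊤)) (π : (k' ≃ₐ[k] k') →* Equiv.Perm (Fin n)),
      s ⊆ Set.range f ∧ (∀ i, P (f i)) ∧ (∀ γ i, (σ.act γ).appTop (f i) = f (π γ i)) ∧
      ∃ E : IntermediateField k k', FiniteDimensional k E ∧ ∀ γ ∈ E.fixingSubgroup, π γ = 1 := by
  classical
  let _ := σ.mulAction
  -- The stabilizer contains the fixing subgroup of a finite extension, hence has finite index.
  have horb (f : Γ(X.left, ⊤)) : (MulAction.orbit (k' ≃ₐ[k] k') f).Finite := by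
    obtain ⟨E, hE, hf⟩ := σ.exists_fixingSubgroup f
    have := finiteIndex_fixingSubgroup E
    have hle : E.fixingSubgroup ≤ MulAction.stabilizer (k' ≃ₐ[k] k') f := fun γ hγ => hf γ hγ
    have := Subgroup.finiteIndex_of_le hle
    have := Finite.of_equiv _ (MulAction.orbitEquivQuotientStabilizer (k' ≃ₐ[k] k') f).symm
    exact Set.toFinite _
  let S : SubMulAction (k' ≃ₐ[k] k') Γ(X.left, ⊤) :=
    { carrier := ⋃ f ∈ s, MulAction.orbit (k' ≃ₐ[k] k') f
      smul_mem' := by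
        intro γ x hx
        simp only [Set.mem_iUnion] at hx ⊢
        obtain ⟨f, hf, hx⟩ := hx
        exact ⟨f, hf, MulAction.mem_orbit_of_mem_orbit γ hx⟩ }
  have hSfin : Finite S := (hs.biUnion fun f _ => horb f).to_subtype
  let e : S ≃ Fin (Nat.card S) := Finite.equivFin S
  choose E hE hfix using fun i => σ.exists_fixingSubgroup (e.symm i : Γ(X.left, ⊤))
  refine ⟨Nat.card S, fun i => e.symm i, e.permCongrHom.toMonoidHom.comp
    (MulAction.toPermHom (k' ≃ₐ[k] k') S), ?_, ?_, ?_, ⨆ i, E i, inferInstance, ?_⟩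
  · intro f hf
    have : f ∈ S := Set.mem_biUnion hf (MulAction.mem_orbit_self f)
    exact ⟨e ⟨f, this⟩, by simp⟩
  · intro i
    have := (e.symm i).2
    obtain ⟨f, hf, γ, hγ⟩ := Set.mem_iUnion₂.1 this
    change P (e.symm i : Γ(X.left, ⊤))
    rw [← hγ]
    exact hPσ γ f (hP f hf)
  · intro γ i
    simp
    rfl
  · intro γ hγ
    ext i
    have := hfix i γ (IntermediateField.fixingSubgroup_antitone (le_iSup E i) hγ)
    have h2 : γ • e.symm i = e.symm i := Subtype.ext this
    simp [h2]

end SmoothVectors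
-- Spectra of monoid algebras are varieties
section Varieties

lemma isVariety_spec {K R : Type u} [Field K] [CommRing R] [Algebra K R] [Algebra.FiniteType K R]
    (h : ∀ (L : Type u) [Field L] [Algebra K L], IsDomain (R ⊗[K] L)) :
    IsVariety ((Spec (.of R)).asOver (Spec (.of K))) where
  separated := inferInstanceAs (IsSeparated (Spec.map _))
  locallyOfFiniteType := locallyOfFiniteType_specOverSpec
  quasiCompact := inferInstanceAs (QuasiCompact (Spec.map _))
  geometricallyIntegral := by
    refine ⟨geometrically_iff_of_commRing.2 fun L _ _ Y p q sq => ?_⟩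
    have := h L
    have e := (pullbackSpecIso K R L).symm ≪≫ (IsPullback.of_hasPullback _ _).isoIsPullback _ _ sq
    exact IsIntegral.of_isIso e.hom

/-- Base change to `L` gives `L[N]`, a domain because `N` has unique sums. The cases `ℕ^n` and `ℤ^n`
yield `𝔸^n` and `𝔾_m^n`. -/
lemma isVariety_addMonoidAlgebra {K : Type u} [Field K] {N : Type*} [AddCommMonoid N]
    [UniqueSums N] {R : Type u} [CommRing R] [Algebra K R] [Algebra.FiniteType K R]
    (e : R ≃ₐ[K] AddMonoidAlgebra K N) :
    IsVariety ((Spec (.of R)).asOver (Spec (.of K))) := by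
  refine isVariety_spec fun L _ _ => ?_
  let e' : R ⊗[K] L ≃ₐ[K] AddMonoidAlgebra L N :=
    (Algebra.TensorProduct.comm K R L).trans <|
      (Algebra.TensorProduct.congr AlgEquiv.refl e).trans <|
      (AddMonoidAlgebra.scalarTensorEquiv K L).restrictScalars K
  exact e'.toMulEquiv.isDomain _

end Varieties

/-! ### Permutation-twisted `k`-structures on `𝔸^n` and `𝔾_m^n` -/

section TwistedStructures

variable {k k' : Type u} [Field k] [Field k'] [Algebra k k']

/-- The `k`-structure on `Spec R` given by a semilinear action on the ring `R` and a form of `R`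
over a finite Galois extension. -/
def KStructure.ofSpec {R : Type u} [CommRing R] [Algebra k' R] (t : (k' ≃ₐ[k] k') → R →+* R)
    (h_one : t 1 = RingHom.id R) (h_mul : ∀ γ γ', t (γ * γ') = (t γ).comp (t γ'))
    (h_semi : ∀ γ c, t γ (algebraMap k' R c) = algebraMap k' R (γ c))
    (K₁ : IntermediateField k k') [FiniteDimensional k K₁] [IsGalois k K₁]
    (R₁ : Type u) [CommRing R₁] [Algebra K₁ R₁] [Algebra R₁ R]
    [IsScalarTower K₁ R₁ R] [Algebra.IsPushout K₁ k' R₁ R]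
    (hvar : IsVariety ((Spec (.of R₁)).asOver (Spec (.of K₁))))
    (hfix : ∀ γ ∈ K₁.fixingSubgroup, ∀ r, t γ (algebraMap R₁ R r) = algebraMap R₁ R r) :
    KStructure k ((Spec (.of R)).asOver (Spec (.of k'))) where
  act γ := Spec.map (CommRingCat.ofHom (t γ))
  act_one := by rw [h_one]; exact Spec.map_id _
  act_mul γ γ' := by
    rw [h_mul, CommRingCat.ofHom_comp, Spec.map_comp]
    rfl
  semilinear γ := by
    refine (Spec.map_comp _ _).symm.trans (Eq.trans ?_ (Spec.map_comp _ _))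
    congr 1
    ext c
    exact h_semi γ c
  continuous := by
    refine ⟨K₁, inferInstance, inferInstance, _, hvar,
      Spec.map (CommRingCat.ofHom (algebraMap R₁ R)), ?_, fun γ hγ => ?_⟩
    · exact (isPullback_SpecMap_of_isPushout _ _ _ _
        (CommRingCat.isPushout_of_isPushout K₁ k' R₁ R)).flip
    · refine (Spec.map_comp _ _).symm.trans ?_
      congr 1
      ext r
      exact hfix γ hγ r

lemma KStructure.ofSpec_act_appTop {R : Type u} [CommRing R] [Algebra k' R]
    {t : (k' ≃ₐ[k] k') → R →+* R} {h_one h_mul h_semi}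
    {K₁ : IntermediateField k k'} [FiniteDimensional k K₁] [IsGalois k K₁]
    {R₁ : Type u} [CommRing R₁] [Algebra K₁ R₁] [Algebra R₁ R]
    [IsScalarTower K₁ R₁ R] [Algebra.IsPushout K₁ k' R₁ R]
    {hvar : IsVariety ((Spec (.of R₁)).asOver (Spec (.of K₁)))} {hfix}
    (γ : k' ≃ₐ[k] k') (r : R) :
    ((KStructure.ofSpec t h_one h_mul h_semi K₁ R₁ hvar hfix).act γ).appTop (specFun R r) =
      specFun R (t γ r) :=
  specMap_appTop _ _

variable {n : ℕ} (π : (k' ≃ₐ[k] k') →* Equiv.Perm (Fin n))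

lemma exists_isGalois_le [IsGalois k k'] (E : IntermediateField k k') [FiniteDimensional k E] :
    ∃ K₁ : IntermediateField k k', FiniteDimensional k K₁ ∧ IsGalois k K₁ ∧ E ≤ K₁ := by
  refine ⟨IntermediateField.normalClosure k E k', inferInstance, ?_, E.le_normalClosure⟩
  exact { }

/-- The semilinear automorphism of the polynomial ring permuting the variables. -/
def polynomialTwist (γ : k' ≃ₐ[k] k') : MvPolynomial (Fin n) k' →+* MvPolynomial (Fin n) k' :=
  MvPolynomial.eval₂Hom (MvPolynomial.C.comp (γ : k' →+* k')) fun i => MvPolynomial.X (π γ i)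

/-- The automorphism of `ℤ^n` permuting the coordinates. -/
def permHom (g : Equiv.Perm (Fin n)) : (Fin n → ℤ) →+ (Fin n → ℤ) where
  -- The inverse is what sends `e_i` to `e_{g i}`, so that exponents move as the variables do.
  toFun v := v ∘ g.symm
  map_zero' := rfl
  map_add' _ _ := rfl

/-- The semilinear automorphism of the Laurent polynomial ring permuting the variables. -/
def laurentTwist (γ : k' ≃ₐ[k] k') :
    AddMonoidAlgebra k' (Fin n → ℤ) →+* AddMonoidAlgebra k' (Fin n → ℤ) :=
  (AddMonoidAlgebra.mapDomainRingHom k' (permHom (π γ))).comp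
    (AddMonoidAlgebra.mapRingHom _ (γ : k' →+* k'))

lemma laurentTwist_single (γ : k' ≃ₐ[k] k') (v : Fin n → ℤ) (c : k') :
    laurentTwist π γ (AddMonoidAlgebra.single v c) =
      AddMonoidAlgebra.single (permHom (π γ) v) (γ c) := by
  simp [laurentTwist, AddMonoidAlgebra.mapDomain_single]

-- Continuity is witnessed by polynomials over a finite Galois `K₁/k` containing `E`: an element
-- fixing `K₁` fixes the coefficients and, having trivial permutation, the variables.
open scoped AlgebraMonoidAlgebra in
attribute [local instance] MvPolynomial.algebraMvPolynomial in
lemma exists_affineSp_structure [IsGalois k k'] (h : ∃ E : IntermediateField k k', FiniteDimensional k E ∧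
    ∀ γ ∈ E.fixingSubgroup, π γ = 1) :
    ∃ σ : KStructure k (affineSp k' n), ∀ γ p,
      (σ.act γ).appTop (specFun (MvPolynomial (Fin n) k') p) =
        specFun _ (polynomialTwist π γ p) := by
  obtain ⟨E, hE, hfix⟩ := h
  obtain ⟨K₁, hfin, hgal, hle⟩ := exists_isGalois_le E
  refine ⟨KStructure.ofSpec (polynomialTwist π) ?_ ?_ ?_ K₁ (MvPolynomial (Fin n) K₁) ?_ ?_,
    KStructure.ofSpec_act_appTop⟩
  · ext <;> simp [polynomialTwist]
  · intro γ γ'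
    ext <;> simp [polynomialTwist]
  · intro γ c
    simp [polynomialTwist]
  · exact isVariety_addMonoidAlgebra (N := Fin n →₀ ℕ) AlgEquiv.refl
  · intro γ hγ p
    refine RingHom.congr_fun (f := (polynomialTwist π γ).comp (MvPolynomial.map (algebraMap K₁ k')))
      (g := MvPolynomial.map (algebraMap K₁ k')) ?_ p
    ext x
    · simp [polynomialTwist, (IntermediateField.mem_fixingSubgroup_iff _ _).1 hγ x x.2]
    · simp [polynomialTwist, hfix γ (IntermediateField.fixingSubgroup_antitone hle hγ)]

open scoped AlgebraMonoidAlgebra in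
lemma exists_Gm_structure [IsGalois k k'] (h : ∃ E : IntermediateField k k', FiniteDimensional k E ∧
    ∀ γ ∈ E.fixingSubgroup, π γ = 1) :
    ∃ τ : KStructure k (Gm k' n), ∀ γ p,
      (τ.act γ).appTop (specFun (AddMonoidAlgebra k' (Fin n → ℤ)) p) =
        specFun _ (laurentTwist π γ p) := by
  obtain ⟨E, hE, hfix⟩ := h
  obtain ⟨K₁, hfin, hgal, hle⟩ := exists_isGalois_le E
  refine ⟨KStructure.ofSpec (laurentTwist π) ?_ ?_ ?_ K₁ (AddMonoidAlgebra K₁ (Fin n → ℤ)) ?_ ?_,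
    KStructure.ofSpec_act_appTop⟩
  · apply AddMonoidAlgebra.ringHom_ext <;> intro <;> simp [laurentTwist_single]; rfl
  · intro γ γ'
    apply AddMonoidAlgebra.ringHom_ext <;> intro <;> simp [laurentTwist_single]; rfl
  · intro γ c
    simp [laurentTwist_single]
  · exact isVariety_addMonoidAlgebra (N := Fin n → ℤ) AlgEquiv.refl
  · intro γ hγ p
    refine RingHom.congr_fun
      (f := (laurentTwist π γ).comp (AddMonoidAlgebra.mapRingHom _ (algebraMap K₁ k')))
      (g := AddMonoidAlgebra.mapRingHom _ (algebraMap K₁ k')) ?_ p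
    apply AddMonoidAlgebra.ringHom_ext
    · intro x
      simp [laurentTwist_single, (IntermediateField.mem_fixingSubgroup_iff _ _).1 hγ x x.2]
    · intro v
      simp [laurentTwist_single, hfix γ (IntermediateField.fixingSubgroup_antitone hle hγ)]
      rfl

end TwistedStructures
-- Coordinate functions on `𝔾_m^n` and `𝔸^n`
section Coordinates

variable {K : Type u} [Field K] {n : ℕ}

/-- The function `x^v` on `𝔾_m^n`. -/
def gmFun (K : Type u) [Field K] {n : ℕ} (v : Fin n → ℤ) : Γ((Gm K n).left, ⊤) :=
  specFun (AddMonoidAlgebra K (Fin n → ℤ)) (AddMonoidAlgebra.single v 1)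

/-- The coordinate function `x_i` on `𝔸^n`. -/
def coordFun (K : Type u) [Field K] {n : ℕ} (i : Fin n) : Γ((affineSp K n).left, ⊤) :=
  specFun (MvPolynomial (Fin n) K) (MvPolynomial.X i)

lemma gmFun_add (v w : Fin n → ℤ) : gmFun K (v + w) = gmFun K v * gmFun K w := by
  refine Eq.trans ?_ (map_mul (specFun (AddMonoidAlgebra K (Fin n → ℤ))) _ _)
  rw [AddMonoidAlgebra.single_mul_single, mul_one]
  rfl

lemma gmFun_zero : gmFun K (0 : Fin n → ℤ) = 1 :=
  map_one (specFun (AddMonoidAlgebra K (Fin n → ℤ)))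

/-- Stated for morphisms of schemes that agree on constants rather than for morphisms over `K`, so
that it applies to semilinear ones. -/
lemma Gm_hom_ext {Z : Scheme.{u}} {f g : Z ⟶ (Gm K n).left}
    (hc : f ≫ (Gm K n).hom = g ≫ (Gm K n).hom)
    (h : ∀ v, f.appTop (gmFun K v) = g.appTop (gmFun K v)) : f = g := by
  apply comorphism_injective
  apply AddMonoidAlgebra.ringHom_ext
  · intro c
    have := congr(comorphism $hc c)
    rw [comp_comorphism, comp_comorphism] at this
    change f.appTop (scalar (Gm K n) c) = g.appTop (scalar (Gm K n) c) at this
    rw [scalar_spec] at this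
    exact this
  · intro m
    exact h m

lemma affineSp_hom_ext {Z : Scheme.{u}} {f g : Z ⟶ (affineSp K n).left}
    (hc : f ≫ (affineSp K n).hom = g ≫ (affineSp K n).hom)
    (h : ∀ i, f.appTop (coordFun K i) = g.appTop (coordFun K i)) : f = g := by
  apply comorphism_injective
  apply MvPolynomial.ringHom_ext
  · intro c
    have := congr(comorphism $hc c)
    rw [comp_comorphism, comp_comorphism] at this
    change f.appTop (scalar (affineSp K n) c) = g.appTop (scalar (affineSp K n) c) at this
    rw [scalar_spec] at this
    exact this
  · intro i
    exact h i

lemma coordFun_ne_zero (i : Fin n) : coordFun K i ≠ 0 := by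
  exact (map_ne_zero_iff (specFun (MvPolynomial (Fin n) K)) (specFun_bijective _).1).2
    (MvPolynomial.X_ne_zero i)

lemma surjective_eval₂Hom_coordFun :
    Function.Surjective (MvPolynomial.eval₂Hom (scalar (affineSp K n)) (coordFun K)) := by
  have : MvPolynomial.eval₂Hom (scalar (affineSp K n)) (coordFun K) =
      specFun (MvPolynomial (Fin n) K) := by
    apply MvPolynomial.ringHom_ext
    · intro c
      rw [MvPolynomial.eval₂Hom_C, scalar_spec]
      rfl
    · intro i
      rw [MvPolynomial.eval₂Hom_X']
      rfl
  rw [this]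
  exact (specFun_bijective _).2

lemma mul_appTop_gmFun (v : Fin n → ℤ) :
    (MonObj.mul (X := Gm K n)).left.appTop (gmFun K v) =
      (fst (Gm K n) (Gm K n)).left.appTop (gmFun K v) *
        (snd (Gm K n) (Gm K n)).left.appTop (gmFun K v) :=
  mul_appTop_of_comul (by simp)

lemma one_appTop_gmFun (v : Fin n → ℤ) :
    (MonObj.one (X := Gm K n)).left.appTop (gmFun K v) = 1 :=
  one_appTop_of_counit (by simp)

/-- The group axiom makes the pullback of `x^v` a multiplicative inverse of `x^v`, and inverses are
unique. -/
lemma inv_appTop_gmFun (v : Fin n → ℤ) :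
    (GrpObj.inv (X := Gm K n)).left.appTop (gmFun K v) = gmFun K (-v) := by
  have h1 := congr(($(GrpObj.right_inv (Gm K n))).left.appTop (gmFun K v))
  rw [Over.comp_left, Over.comp_left, appTop_comp_apply, appTop_comp_apply, mul_appTop_gmFun,
    one_appTop_gmFun, map_one, map_mul, ← appTop_comp_apply, ← appTop_comp_apply,
    ← Over.comp_left, ← Over.comp_left, lift_fst, lift_snd] at h1
  have h2 : gmFun K v * gmFun K (-v) = 1 := by rw [← gmFun_add, add_neg_cancel, gmFun_zero]
  have h3 : (𝟙 (Gm K n) : Gm K n ⟶ Gm K n).left.appTop (gmFun K v) = gmFun K v := by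
    simp
  rw [h3] at h1
  calc _ = (gmFun K v * gmFun K (-v)) * (GrpObj.inv (X := Gm K n)).left.appTop (gmFun K v) := by
        rw [h2, one_mul]
    _ = (gmFun K v * (GrpObj.inv (X := Gm K n)).left.appTop (gmFun K v)) * gmFun K (-v) := by ring
    _ = _ := by rw [h1, one_mul]

lemma gmInclusion_appTop_coordFun (i : Fin n) :
    (gmInclusion K n).left.appTop (coordFun K i) = gmFun K (Pi.single i 1) := by
  refine (specMap_appTop (MvPolynomial.aeval (R := K) (gmCoord K n)).toRingHom _).trans ?_
  rw [gmFun]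
  congr 1
  exact MvPolynomial.aeval_X _ _

lemma gmAction_appTop_coordFun (i : Fin n) :
    (gmAction K n).left.appTop (coordFun K i) =
      (fst (Gm K n) (affineSp K n)).left.appTop (gmFun K (Pi.single i 1)) *
        (snd (Gm K n) (affineSp K n)).left.appTop (coordFun K i) := by
  refine (appTop_comp_apply (pullbackSpecIso K _ _).hom
    (Spec.map (CommRingCat.ofHom (gmCoaction K n).toRingHom)) _).trans ?_
  rw [coordFun, specMap_appTop]
  have : (gmCoaction K n).toRingHom (MvPolynomial.X i) = gmCoord K n i ⊗ₜ MvPolynomial.X i :=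
    MvPolynomial.aeval_X _ _
  rw [this, pullbackSpecIso_hom_appTop_tmul]
  rfl

end Coordinates

/-! ### The homomorphism of tori dual to `e_i ↦ w_i` -/

section WeightMap

variable {K : Type u} [Field K] {M : Type u} [AddCommGroup M] {n : ℕ}

/-- The homomorphism `ℤ^n → M` with given values on the standard basis. -/
def weightMap (w : Fin n → M) : (Fin n → ℤ) →+ M :=
  (Fintype.linearCombination ℤ w).toAddMonoidHom

lemma weightMap_single (w : Fin n → M) (i : Fin n) : weightMap w (Pi.single i 1) = w i := by
  classical
  exact (Fintype.linearCombination_apply_single ℤ w i 1).trans (one_smul _ _)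

lemma closure_range_le_range_weightMap (w : Fin n → M) :
    AddSubmonoid.closure (Set.range w) ≤ (weightMap w).range.toAddSubmonoid := by
  rw [AddSubmonoid.closure_le]
  rintro _ ⟨i, rfl⟩
  exact ⟨_, weightMap_single w i⟩

/-- The homomorphism of tori dual to `ℤ^n → M`. -/
def torusHom (K : Type u) [Field K] (w : Fin n → M) : splitTorus K M ⟶ Gm K n :=
  Scheme.Hom.asOver (Spec.map (CommRingCat.ofHom
    (AddMonoidAlgebra.mapDomainAlgHom K K (weightMap w)).toRingHom)) (Spec (.of K))

lemma torusHom_appTop_gmFun (w : Fin n → M) (v : Fin n → ℤ) :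
    (torusHom K w).left.appTop (gmFun K v) = character (weightMap w v) := by
  refine (specMap_appTop (AddMonoidAlgebra.mapDomainAlgHom K K (weightMap w)).toRingHom _).trans ?_
  rw [character_eq_specFun]
  congr 1
  exact AddMonoidAlgebra.mapDomain_single

lemma isClosedImmersion_torusHom {w : Fin n → M} (h : Function.Surjective (weightMap w)) :
    IsClosedImmersion (torusHom K w).left :=
  IsClosedImmersion.spec_of_surjective _ fun p => by
    obtain ⟨q, hq⟩ := Finsupp.mapDomain_surjective (M := K) h p.coeff
    exact ⟨.ofCoeff q, congr(AddMonoidAlgebra.ofCoeff $hq)⟩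

lemma isMonHom_torusHom (w : Fin n → M) : IsMonHom (torusHom K w) where
  one_hom := by
    ext1
    refine Gm_hom_ext (by rw [Over.w, Over.w]) fun v => ?_
    rw [Over.comp_left, appTop_comp_apply, torusHom_appTop_gmFun, one_appTop_character,
      one_appTop_gmFun]
  mul_hom := by
    ext1
    refine Gm_hom_ext (by rw [Over.w, Over.w]) fun v => ?_
    rw [Over.comp_left, appTop_comp_apply, torusHom_appTop_gmFun, mul_appTop_character,
      Over.comp_left, appTop_comp_apply, mul_appTop_gmFun, map_mul, ← appTop_comp_apply,
      ← appTop_comp_apply, ← Over.comp_left, ← Over.comp_left, tensorHom_fst, tensorHom_snd,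
      Over.comp_left, Over.comp_left, appTop_comp_apply, appTop_comp_apply, torusHom_appTop_gmFun]
    rfl

/-- Under `𝔾_m^n` the coordinate `x_i` has weight `e_i`, which restricts to `w_i` on `T`. -/
lemma isSemiInvariant_coordFun (w : Fin n → M) (i : Fin n) :
    IsSemiInvariant (restrictedAction (torusHom K w)) (w i) (coordFun K i) := by
  rw [isSemiInvariant_iff, restrictedAction, Over.comp_left, appTop_comp_apply,
    gmAction_appTop_coordFun, map_mul, ← appTop_comp_apply, ← appTop_comp_apply, ← Over.comp_left,
    ← Over.comp_left, whiskerRight_fst, whiskerRight_snd, Over.comp_left, appTop_comp_apply,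
    torusHom_appTop_gmFun, weightMap_single]
  rfl

end WeightMap

/-! ### Embedding `X` in affine space and meeting the open orbit -/

section Embedding

variable {K : Type u} [Field K] {X : Over (Spec (.of K))} {n : ℕ}

/-- The morphism `X ⟶ 𝔸^n` given by `n` functions on `X`. -/
def toAffineSp (f : Fin n → Γ(X.left, ⊤)) : X ⟶ affineSp K n :=
  Over.homMk (toSpec (MvPolynomial.eval₂Hom (scalar X) f)) (by
    apply comorphism_injective
    ext c
    refine (comp_comorphism _ (affineSp K n).hom c).trans ?_
    change (toSpec _).appTop (scalar (affineSp K n) c) = scalar X c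
    rw [scalar_spec, ← comorphism_apply, comorphism_toSpec]
    exact MvPolynomial.eval₂Hom_C _ _ _)

lemma toAffineSp_appTop_coordFun (f : Fin n → Γ(X.left, ⊤)) (i : Fin n) :
    (toAffineSp f).left.appTop (coordFun K i) = f i := by
  refine (comorphism_apply (toSpec _) _).symm.trans ?_
  rw [comorphism_toSpec]
  exact MvPolynomial.eval₂Hom_X' _ _ _

lemma isClosedImmersion_toAffineSp [IsAffine X.left] {f : Fin n → Γ(X.left, ⊤)}
    (h : Function.Surjective (MvPolynomial.eval₂Hom (scalar X) f)) :
    IsClosedImmersion (toAffineSp f).left := by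
  have := IsClosedImmersion.spec_of_surjective
    (CommRingCat.ofHom (MvPolynomial.eval₂Hom (scalar X) f)) h
  change IsClosedImmersion (X.left.isoSpec.hom ≫ Spec.map _)
  infer_instance

/-- A homomorphism from `K[x_1^{±1}, …, x_n^{±1}]` to a field with given nonzero values of the
`x_i`. -/
lemma exists_laurent_eval {F : Type u} [Field F] (c : K →+* F) {t : Fin n → F} (ht : ∀ i, t i ≠ 0) :
    ∃ φ : AddMonoidAlgebra K (Fin n → ℤ) →+* F,
      (∀ a, φ (AddMonoidAlgebra.single 0 a) = c a) ∧
      ∀ i, φ (AddMonoidAlgebra.single (Pi.single i 1) 1) = t i := by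
  let : Algebra K F := c.toAlgebra
  let χ : Multiplicative (Fin n → ℤ) →* F :=
    { toFun := fun v => ∏ i, t i ^ (v.toAdd i)
      map_one' := by simp
      map_mul' := fun v w => by
        simp only [toAdd_mul, Pi.add_apply, zpow_add₀ (ht _), Finset.prod_mul_distrib] }
  refine ⟨(AddMonoidAlgebra.lift K F (Fin n → ℤ) χ).toRingHom, fun a => ?_, fun i => ?_⟩
  · exact (AddMonoidAlgebra.lift K F (Fin n → ℤ) χ).commutes a
  · refine (AddMonoidAlgebra.lift_single ..).trans ?_
    rw [one_smul]
    change ∏ j, t j ^ (Pi.single i (1 : ℤ) : Fin n → ℤ) j = t i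
    rw [Finset.prod_eq_single i (fun b _ hb => by rw [Pi.single_eq_of_ne hb, zpow_zero])
      (by simp), Pi.single_eq_same, zpow_one]

/-- The `F`-point of `X` defined by `ι` has coordinates `ι (f i)`, all nonzero, so its image in
`𝔸^n` factors through `𝔾_m^n`. -/
lemma range_toAffineSp_inter_nonempty_of_injective [IsAffine X.left] {F : Type u} [Field F]
    {ι : Γ(X.left, ⊤) →+* F} (hι : Function.Injective ι) {f : Fin n → Γ(X.left, ⊤)}
    (h0 : ∀ i, f i ≠ 0) :
    (Set.range (toAffineSp f).left ∩ Set.range (gmInclusion K n).left).Nonempty := by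
  obtain ⟨y, hy⟩ : ∃ y : Spec (.of F) ⟶ X.left,
      ∀ s : Γ(X.left, ⊤), y.appTop s = specFun F (ι s) := by
    refine ⟨Spec.map (CommRingCat.ofHom ι) ≫ X.left.isoSpec.inv, fun s => ?_⟩
    have h1 : X.left.isoSpec.inv.appTop s = specFun Γ(X.left, ⊤) s := by
      have h2 : X.left.isoSpec.hom.appTop (specFun Γ(X.left, ⊤) s) = s := toSpecΓ_appTop_specFun s
      conv_lhs => rw [← h2]
      rw [← appTop_comp_apply, Iso.inv_hom_id]
      rfl
    rw [appTop_comp_apply, h1, specMap_appTop]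
  obtain ⟨φ, hφc, hφ⟩ := exists_laurent_eval (ι.comp (scalar X))
    fun i => (map_ne_zero_iff ι hι).2 (h0 i)
  obtain ⟨z, hz⟩ : ∃ z : Spec (.of F) ⟶ (Gm K n).left,
      ∀ p, z.appTop (specFun (AddMonoidAlgebra K (Fin n → ℤ)) p) = specFun F (φ p) :=
    ⟨Spec.map (CommRingCat.ofHom φ), specMap_appTop φ⟩
  have key : y ≫ (toAffineSp f).left = z ≫ (gmInclusion K n).left := by
    apply affineSp_hom_ext
    · rw [Category.assoc, Category.assoc, Over.w, Over.w]
      apply comorphism_injective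
      ext c
      rw [comp_comorphism, comp_comorphism]
      change y.appTop (scalar X c) = z.appTop (scalar (Gm K n) c)
      rw [hy, scalar_spec, hz]
      exact congr(specFun F $(hφc c)).symm
    · intro i
      rw [appTop_comp_apply, appTop_comp_apply, toAffineSp_appTop_coordFun,
        gmInclusion_appTop_coordFun, hy, gmFun, hz, hφ]
  obtain ⟨x⟩ : Nonempty (Spec (.of F)) := inferInstance
  refine ⟨(toAffineSp f).left (y x), ⟨y x, rfl⟩, z x, ?_⟩
  rw [← Scheme.Hom.comp_apply, ← Scheme.Hom.comp_apply, key]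

/-- If the functions are nonzero on an integral `X`, the image of the generic point lies in the
open orbit. -/
lemma range_toAffineSp_inter_nonempty [IsAffine X.left] [IsIntegral X.left]
    {f : Fin n → Γ(X.left, ⊤)} (h0 : ∀ i, f i ≠ 0) :
    (Set.range (toAffineSp f).left ∩ Set.range (gmInclusion K n).left).Nonempty :=
  range_toAffineSp_inter_nonempty_of_injective
    (FaithfulSMul.algebraMap_injective Γ(X.left, ⊤) (FractionRing Γ(X.left, ⊤))) h0

end Embedding

/-! ### Semilinear automorphisms of products -/

section ProductAction

variable {k k' : Type u} [Field k] [Field k'] [Algebra k k'] {X Y : Over (Spec (.of k'))}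
  (σ : KStructure k X) (τ : KStructure k Y) (γ : k' ≃ₐ[k] k')

lemma KStructure.prodAct_fst : σ.prodAct τ γ ≫ (fst X Y).left = (fst X Y).left ≫ σ.act γ :=
  pullback.lift_fst _ _ _

lemma KStructure.prodAct_snd : σ.prodAct τ γ ≫ (snd X Y).left = (snd X Y).left ≫ τ.act γ :=
  pullback.lift_snd _ _ _

lemma KStructure.prodAct_hom : σ.prodAct τ γ ≫ (X ⊗ Y).hom = (X ⊗ Y).hom ≫ specGal k γ := by
  rw [← Over.w (fst X Y), ← Category.assoc, prodAct_fst, Category.assoc, Category.assoc,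
    σ.semilinear]

lemma KStructure.prodAct_appTop_mul (a : Γ(X.left, ⊤)) (b : Γ(Y.left, ⊤)) :
    (σ.prodAct τ γ).appTop ((fst X Y).left.appTop a * (snd X Y).left.appTop b) =
      (fst X Y).left.appTop ((σ.act γ).appTop a) * (snd X Y).left.appTop ((τ.act γ).appTop b) := by
  rw [map_mul, ← appTop_comp_apply, ← appTop_comp_apply, prodAct_fst, prodAct_snd,
    appTop_comp_apply, appTop_comp_apply]

lemma KStructure.act_appTop_injective : Function.Injective (σ.act γ).appTop := by
  intro f g h
  have h1 : σ.act γ⁻¹ ≫ σ.act γ = 𝟙 _ := by rw [← σ.act_mul, inv_mul_cancel, σ.act_one]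
  have h2 (f : Γ(X.left, ⊤)) : (σ.act γ⁻¹).appTop ((σ.act γ).appTop f) = f := by
    rw [← appTop_comp_apply, h1]
    rfl
  rw [← h2 f, h, h2]

/-- Two semilinear morphisms agree on constants. -/
lemma semilinear_comp_hom {f : X ⟶ Y} :
    (σ.act γ ≫ f.left) ≫ Y.hom = (f.left ≫ τ.act γ) ≫ Y.hom := by
  rw [Category.assoc, Category.assoc, Over.w, τ.semilinear, σ.semilinear, Over.w_assoc]

lemma semilinear_prod_comp_hom {Z : Over (Spec (.of k'))} (ζ : KStructure k Z) {f : X ⊗ Y ⟶ Z} :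
    (σ.prodAct τ γ ≫ f.left) ≫ Z.hom = (f.left ≫ ζ.act γ) ≫ Z.hom := by
  rw [Category.assoc, Category.assoc, Over.w, ζ.semilinear, KStructure.prodAct_hom, Over.w_assoc]

end ProductAction

/-! ### Galois action on characters and on weights -/

section TorusStructure

variable {k k' : Type u} [Field k] [Field k'] [Algebra k k'] {M : Type u} [AddCommGroup M]

lemma character_injective {K : Type u} [Field K] :
    Function.Injective (character (K := K) (M := M)) := fun m m' h => by
  have := (specFun_bijective (AddMonoidAlgebra K M)).1 h
  exact (AddMonoidAlgebra.single_left_inj one_ne_zero).1 this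

lemma character_ne_zero {K : Type u} [Field K] (m : M) : character (K := K) m ≠ 0 :=
  (map_ne_zero_iff (specFun (AddMonoidAlgebra K M)) (specFun_bijective _).1).2
    ((AddMonoidAlgebra.single_ne_zero).2 one_ne_zero)

/-- Every function on a split torus is a linear combination of characters. -/
lemma exists_sum_scalar_mul_character {K : Type u} [Field K] (h : Γ((splitTorus K M).left, ⊤)) :
    ∃ c : M →₀ K, h = ∑ m ∈ c.support, scalar (splitTorus K M) (c m) * character m := by
  obtain ⟨p, rfl⟩ := (specFun_bijective (AddMonoidAlgebra K M)).2 h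
  have hmon (m : M) : specFun (AddMonoidAlgebra K M) (AddMonoidAlgebra.single m (p.coeff m)) =
      scalar (splitTorus K M) (p.coeff m) * character m := by
    rw [scalar_spec, character_eq_specFun]
    refine Eq.trans ?_ (map_mul (specFun (AddMonoidAlgebra K M)) _ _)
    simp [AddMonoidAlgebra.single_mul_single]
  refine ⟨p.coeff, ?_⟩
  conv_lhs => rw [← AddMonoidAlgebra.sum_coeff_single p]
  rw [Finsupp.sum, map_sum]
  exact Finset.sum_congr rfl fun m _ => hmon m

/-- A nonzero function `h` on a split torus with `μ^♯ h = h ⊗ h` is a character. -/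
lemma eq_character_of_mul_appTop {K : Type u} [Field K] {h : Γ((splitTorus K M).left, ⊤)}
    (h0 : h ≠ 0) (hmul : (MonObj.mul (X := splitTorus K M)).left.appTop h =
      (fst (splitTorus K M) (splitTorus K M)).left.appTop h *
        (snd (splitTorus K M) (splitTorus K M)).left.appTop h) :
    ∃ m, h = character m := by
  obtain ⟨p, hp⟩ := exists_sum_scalar_mul_character h
  have hsemi (m : M) := (isSemiInvariant_scalar (a := MonObj.mul (X := splitTorus K M))
    (p m)).mul (mul_appTop_character m)
  have hfst (m : M) : (fst (splitTorus K M) (splitTorus K M)).left.appTop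
      (scalar (splitTorus K M) (p m) * character m) *
      (snd (splitTorus K M) (splitTorus K M)).left.appTop h =
      charMul m (scalar (splitTorus K M) (p m) * h) := by
    rw [charMul, map_mul, map_mul, appTop_scalar, appTop_scalar]
    ring
  -- With `h = ∑ p_m χ^m`, the two sides of `hmul` expand as `∑ χ^m ⊗ p_m χ^m` and `∑ χ^m ⊗ p_m h`.
  -- Hence `p_m χ^m = p_m h` for all `m`, and any `m` with `p_m ≠ 0` serves.
  have key := charMul_sum_injective (K := K) (M := M) (X := splitTorus K M)
    (c := Finsupp.onFinset p.support
      (fun m => scalar (splitTorus K M) (p m) * character m) fun m hm => by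
        rw [Finsupp.mem_support_iff]
        rintro h
        exact hm (by rw [h, map_zero, zero_mul]))
    (c' := Finsupp.onFinset p.support
      (fun m => scalar (splitTorus K M) (p m) * h)
      fun m hm => by
        rw [Finsupp.mem_support_iff]
        rintro h
        exact hm (by rw [h, map_zero, zero_mul])) (by
    rw [Finsupp.onFinset_sum _ charMul_zero, Finsupp.onFinset_sum _ charMul_zero]
    simp only [← hfst]
    rw [← Finset.sum_mul, ← map_sum, ← hp, ← hmul]
    conv_rhs => rw [hp, map_sum]
    refine Finset.sum_congr rfl fun m _ => ?_
    have := hsemi m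
    rw [zero_add, isSemiInvariant_iff] at this
    exact this.symm)
  have hp0 : p ≠ 0 := by
    rintro rfl
    exact h0 (by rw [hp, Finsupp.support_zero, Finset.sum_empty])
  obtain ⟨m, hm⟩ := Finsupp.ne_iff.1 hp0
  have hu : scalar (splitTorus K M) (p m)⁻¹ * scalar (splitTorus K M) (p m) = 1 := by
    rw [← map_mul, inv_mul_cancel₀ hm, map_one]
  have h1 : scalar (splitTorus K M) (p m) * character m = scalar (splitTorus K M) (p m) * h :=
    congr($key m)
  refine ⟨m, ?_⟩
  rw [← one_mul h, ← hu, mul_assoc, ← h1, ← mul_assoc, hu, one_mul]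

/-- A `k`-group structure on a split torus permutes the characters. -/
lemma KStructure.IsGroupStructure.exists_character {τ : KStructure k (splitTorus k' M)}
    (hτ : τ.IsGroupStructure) (γ : k' ≃ₐ[k] k') (m : M) :
    ∃ m', (τ.act γ).appTop (character m) = character m' := by
  apply eq_character_of_mul_appTop
  · rw [← map_zero (τ.act γ).appTop.hom]
    exact fun h => character_ne_zero m (τ.act_appTop_injective γ h)
  · rw [← appTop_comp_apply, ← hτ.mul γ, appTop_comp_apply, mul_appTop_character]
    exact τ.prodAct_appTop_mul τ γ _ _

/-- Applying the semilinear automorphism of `T × X` to `a^♯ f = χ^m ⊗ f` transforms both factors. -/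
lemma ActsOver.isSemiInvariant {τ : KStructure k (splitTorus k' M)} {X : Over (Spec (.of k'))}
    {σ : KStructure k X} {a : splitTorus k' M ⊗ X ⟶ X} (hact : ActsOver τ σ a) {γ : k' ≃ₐ[k] k'}
    {m m' : M} (hm : (τ.act γ).appTop (character m) = character m') {f : Γ(X.left, ⊤)}
    (hf : IsSemiInvariant a m f) : IsSemiInvariant a m' ((σ.act γ).appTop f) := by
  rw [isSemiInvariant_iff, ← appTop_comp_apply, ← hact γ, appTop_comp_apply,
    isSemiInvariant_iff.1 hf, charMul, τ.prodAct_appTop_mul, hm]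
  rfl

end TorusStructure

/-! ### Galois-stable semi-invariant generators -/

section Generators

variable {K : Type u} [Field K]

/-- Generation is phrased through subrings containing the constants, so that it can be tested on the
range of an evaluation map. -/
lemma exists_finite_generators {X : Over (Spec (.of K))} [IsAffine X.left]
    [LocallyOfFiniteType X.hom] :
    ∃ s : Finset Γ(X.left, ⊤), ∀ S : Subring Γ(X.left, ⊤),
      (∀ c, scalar X c ∈ S) → (∀ f ∈ s, f ∈ S) → S = ⊤ := by
  have h1 : X.hom.appTop.hom.FiniteType :=
    (HasRingHomProperty.iff_of_isAffine (P := @LocallyOfFiniteType)).1 inferInstance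
  have h2 : (scalar X).FiniteType :=
    h1.comp (RingHom.FiniteType.of_surjective _ (specFun_bijective K).2)
  let : Algebra K Γ(X.left, ⊤) := (scalar X).toAlgebra
  have h3 : Algebra.FiniteType K Γ(X.left, ⊤) := h2
  obtain ⟨s, hs⟩ := h3.out
  refine ⟨s, fun S hc hf => ?_⟩
  rw [eq_top_iff]
  intro x _
  have hx : x ∈ Algebra.adjoin K (s : Set Γ(X.left, ⊤)) := hs ▸ trivial
  induction hx using Algebra.adjoin_induction with
  | mem x hx => exact hf x hx
  | algebraMap c => exact hc c
  | add x y _ _ hx hy => exact add_mem (hx trivial) (hy trivial)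
  | mul x y _ _ hx hy => exact mul_mem (hx trivial) (hy trivial)

variable {k k' : Type u} [Field k] [Field k'] [Algebra k k'] [IsGalois k k']
  {M : Type u} [AddCommGroup M]

/-- The functions on an affine variety with a torus action over `k` are generated by finitely many
semi-invariants that are permuted by the Galois group. -/
lemma exists_equivariant_generators {τ : KStructure k (splitTorus k' M)}
    (hτ : τ.IsGroupStructure) {X : Over (Spec (.of k'))} [IsAffine X.left]
    [LocallyOfFiniteType X.hom] (σ : KStructure k X) [ModObj (splitTorus k' M) X]
    (hact : ActsOver τ σ (ModObj.smul (M := splitTorus k' M) (X := X))) :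
    ∃ (n : ℕ) (f : Fin n → Γ(X.left, ⊤)) (w : Fin n → M)
      (π : (k' ≃ₐ[k] k') →* Equiv.Perm (Fin n)),
      (∀ i, f i ≠ 0) ∧
      (∀ i, IsSemiInvariant (ModObj.smul (M := splitTorus k' M) (X := X)) (w i) (f i)) ∧
      Function.Surjective (MvPolynomial.eval₂Hom (scalar X) f) ∧
      (∀ γ i, (σ.act γ).appTop (f i) = f (π γ i)) ∧
      (∀ γ i, (τ.act γ).appTop (character (w i)) = character (w (π γ i))) ∧
      ∃ E : IntermediateField k k', FiniteDimensional k E ∧ ∀ γ ∈ E.fixingSubgroup, π γ = 1 := by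
  obtain ⟨s, hs⟩ := exists_finite_generators (X := X)
  choose c hc hcw using fun f : Γ(X.left, ⊤) => exists_sum_isSemiInvariant (K := k') (M := M) f
  -- The set to be closed up under `Γ` consists of the nonzero weight components of the generators.
  -- Being a nonzero semi-invariant is a Galois-stable property, so the enlarged set keeps it.
  obtain ⟨n, f, π, hsub, hP, hπ, hE⟩ := σ.exists_permutation
    (⋃ g ∈ (s : Set Γ(X.left, ⊤)), c g '' (c g).support)
    (s.finite_toSet.biUnion fun g _ => (c g).support.finite_toSet.image _)
    (fun f => f ≠ 0 ∧ ∃ m, IsSemiInvariant (ModObj.smul (M := splitTorus k' M) (X := X)) m f)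
    (by
      simp only [Set.mem_iUnion]
      rintro _ ⟨g, -, m, hm, rfl⟩
      exact ⟨Finsupp.mem_support_iff.1 hm, m, hcw g m⟩)
    (by
      rintro γ f ⟨h0, m, hm⟩
      obtain ⟨m', hm'⟩ := hτ.exists_character γ m
      refine ⟨?_, m', hact.isSemiInvariant hm' hm⟩
      rw [← map_zero (σ.act γ).appTop.hom]
      exact fun h => h0 (σ.act_appTop_injective γ h))
  choose h0 w hw using hP
  refine ⟨n, f, w, π, h0, hw, ?_, hπ, fun γ i => ?_, hE⟩
  · rw [← RingHom.range_eq_top]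
    refine hs _ (fun a => ⟨MvPolynomial.C a, MvPolynomial.eval₂Hom_C _ _ _⟩) fun g hg => ?_
    rw [hc g]
    refine sum_mem fun m hm => ?_
    obtain ⟨i, hi⟩ := hsub (Set.mem_biUnion hg ⟨m, hm, rfl⟩)
    exact ⟨MvPolynomial.X i, (MvPolynomial.eval₂Hom_X' _ _ _).trans hi⟩
  · obtain ⟨m', hm'⟩ := hτ.exists_character γ (w i)
    have h1 := hact.isSemiInvariant hm' (hw i)
    rw [hπ] at h1
    rw [hm', h1.weight_unique (hw _) (h0 _)]

end Generators

/-! ### Compatibility of the constructed morphisms with Galois and torus actions -/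

section Permutation

variable {k k' : Type u} [Field k] [Field k'] [Algebra k k'] {n : ℕ}
  {π : (k' ≃ₐ[k] k') →* Equiv.Perm (Fin n)}

lemma permHom_single (g : Equiv.Perm (Fin n)) (i : Fin n) :
    permHom g (Pi.single i 1) = Pi.single (g i) 1 := by
  ext j
  change (Pi.single i 1 : Fin n → ℤ) (g.symm j) = _
  simp only [Pi.single_apply, Equiv.symm_apply_eq]

variable {τ' : KStructure k (Gm k' n)} {σ' : KStructure k (affineSp k' n)}

lemma act_appTop_gmFun (hτ' : ∀ γ p, (τ'.act γ).appTop
    (specFun (AddMonoidAlgebra k' (Fin n → ℤ)) p) = specFun _ (laurentTwist π γ p))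
    (γ : k' ≃ₐ[k] k') (v : Fin n → ℤ) :
    (τ'.act γ).appTop (gmFun k' v) = gmFun k' (permHom (π γ) v) := by
  refine (hτ' γ _).trans ?_
  rw [laurentTwist_single, map_one]
  rfl

lemma act_appTop_coordFun (hσ' : ∀ γ p, (σ'.act γ).appTop
    (specFun (MvPolynomial (Fin n) k') p) = specFun _ (polynomialTwist π γ p))
    (γ : k' ≃ₐ[k] k') (i : Fin n) :
    (σ'.act γ).appTop (coordFun k' i) = coordFun k' (π γ i) := by
  refine (hσ' γ _).trans ?_
  rw [polynomialTwist, MvPolynomial.eval₂Hom_X']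
  rfl

lemma isGroupStructure_of_act_appTop_gmFun
    (hτ' : ∀ γ v, (τ'.act γ).appTop (gmFun k' v) = gmFun k' (permHom (π γ) v)) :
    τ'.IsGroupStructure where
  mul γ := by
    refine Gm_hom_ext (semilinear_prod_comp_hom _ _ _ _) fun v => ?_
    rw [appTop_comp_apply, appTop_comp_apply, mul_appTop_gmFun, τ'.prodAct_appTop_mul, hτ',
      mul_appTop_gmFun]
  inv γ := by
    refine Gm_hom_ext (semilinear_comp_hom _ _ _) fun v => ?_
    rw [appTop_comp_apply, appTop_comp_apply, inv_appTop_gmFun, hτ', hτ', inv_appTop_gmFun, map_neg]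
  one γ := by
    refine Gm_hom_ext ?_ fun v => ?_
    · rw [Category.assoc, Category.assoc, τ'.semilinear, Over.w_assoc, Over.w]
      exact (Category.comp_id _).trans (Category.id_comp _).symm
    · rw [appTop_comp_apply, appTop_comp_apply, one_appTop_gmFun, map_one, hτ', one_appTop_gmFun]

lemma isKMorphism_gmInclusion
    (hτ' : ∀ γ v, (τ'.act γ).appTop (gmFun k' v) = gmFun k' (permHom (π γ) v))
    (hσ' : ∀ γ i, (σ'.act γ).appTop (coordFun k' i) = coordFun k' (π γ i)) :
    IsKMorphism τ' σ' (gmInclusion k' n) := by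
  intro γ
  refine affineSp_hom_ext (semilinear_comp_hom _ _ _) fun i => ?_
  rw [appTop_comp_apply, appTop_comp_apply, gmInclusion_appTop_coordFun, hτ', permHom_single, hσ',
    gmInclusion_appTop_coordFun]

variable {M : Type u} [AddCommGroup M] {w : Fin n → M} {τ : KStructure k (splitTorus k' M)}

lemma isKMorphism_torusHom (hτ : τ.IsGroupStructure)
    (hw : ∀ γ i, (τ.act γ).appTop (character (w i)) = character (w (π γ i)))
    (hτ' : ∀ γ v, (τ'.act γ).appTop (gmFun k' v) = gmFun k' (permHom (π γ) v)) :
    IsKMorphism τ τ' (torusHom k' w) := by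
  intro γ
  choose θ hθ using hτ.exists_character γ
  let θ' : M →+ M := AddMonoidHom.mk' θ fun m m' => by
    apply character_injective (K := k')
    rw [character_add, ← hθ, ← hθ, ← hθ, ← map_mul, ← character_add]
  -- Two additive maps `ℤ^n → M` are compared on the standard basis, where this is the rule by which
  -- `Γ` permutes the `w i`.
  have key : θ'.comp (weightMap w) = (weightMap w).comp (permHom (π γ)) := by
    ext i
    apply character_injective (K := k')
    change character (θ (weightMap w (Pi.single i 1))) =
      character (weightMap w (permHom (π γ) (Pi.single i 1)))
    rw [← hθ, permHom_single, weightMap_single, weightMap_single, hw]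
  refine Gm_hom_ext (semilinear_comp_hom _ _ _) fun v => ?_
  rw [appTop_comp_apply, appTop_comp_apply, torusHom_appTop_gmFun, hτ', torusHom_appTop_gmFun, hθ]
  exact congr(character ($key v))

lemma actsOver_restrictedAction
    (hw : ∀ γ i, (τ.act γ).appTop (character (w i)) = character (w (π γ i)))
    (hσ' : ∀ γ i, (σ'.act γ).appTop (coordFun k' i) = coordFun k' (π γ i)) :
    ActsOver τ σ' (restrictedAction (torusHom k' w)) := by
  intro γ
  refine affineSp_hom_ext (semilinear_prod_comp_hom _ _ _ _) fun i => ?_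
  rw [appTop_comp_apply, appTop_comp_apply, hσ',
    isSemiInvariant_iff.1 (isSemiInvariant_coordFun w _),
    isSemiInvariant_iff.1 (isSemiInvariant_coordFun w _), charMul, τ.prodAct_appTop_mul, hw, hσ']
  rfl

lemma isKMorphism_toAffineSp {X : Over (Spec (.of k'))} {σ : KStructure k X}
    {f : Fin n → Γ(X.left, ⊤)} (hf : ∀ γ i, (σ.act γ).appTop (f i) = f (π γ i))
    (hσ' : ∀ γ i, (σ'.act γ).appTop (coordFun k' i) = coordFun k' (π γ i)) :
    IsKMorphism σ σ' (toAffineSp f) := by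
  intro γ
  refine affineSp_hom_ext (semilinear_comp_hom _ _ _) fun i => ?_
  rw [appTop_comp_apply, appTop_comp_apply, toAffineSp_appTop_coordFun, hf, hσ',
    toAffineSp_appTop_coordFun]

/-- Equivariance is checked on coordinates: `x_i` and its pullback `f i` have the same weight `w i`.
-/
lemma comp_toAffineSp_eq {K : Type u} [Field K] {X : Over (Spec (.of K))}
    {a : splitTorus K M ⊗ X ⟶ X} {f : Fin n → Γ(X.left, ⊤)}
    (hf : ∀ i, IsSemiInvariant a (w i) (f i)) :
    a ≫ toAffineSp f = (splitTorus K M ◁ toAffineSp f) ≫ restrictedAction (torusHom K w) := by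
  ext1
  refine affineSp_hom_ext (by rw [Over.w, Over.w]) fun i => ?_
  rw [Over.comp_left, Over.comp_left, appTop_comp_apply, appTop_comp_apply,
    toAffineSp_appTop_coordFun, isSemiInvariant_iff.1 (hf i),
    isSemiInvariant_iff.1 (isSemiInvariant_coordFun w i), whiskerLeft_appTop_charMul,
    toAffineSp_appTop_coordFun]

end Permutation

instance isAffine_affineSp_left {K : Type u} [Field K] {n : ℕ} : IsAffine (affineSp K n).left :=
  inferInstanceAs (IsAffine (Spec _))

end GaloisTorus

end


/-! ### The equivariant embedding theorem -/

open GaloisTorus in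
theorem proposition4 {k k' : Type u} [Field k] [CharZero k] [Field k'] [Algebra k k']
    [IsGalois k k']
    -- the torus `T = Spec k'[M]`, with `M` a lattice, and a `k`-group structure `τ` on it
    {M : Type u} [AddCommGroup M] [Module.Free ℤ M] [Module.Finite ℤ M]
    (τ : KStructure k (splitTorus k' M)) (hτ : τ.IsGroupStructure)
    -- the affine variety `X` over `k'` with a `k`-structure `σ`
    (X : Over (Spec (.of k'))) [IsAffine X.left] (hX : IsVariety X) (σ : KStructure k X)
    -- the effective action of `(T, τ)` on `(X, σ)`
    [ModObj (splitTorus k' M) X]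
    (hact : ActsOver τ σ (ModObj.smul (M := splitTorus k' M) (X := X)))
    (heff : IsEffective (ModObj.smul (M := splitTorus k' M) (X := X))) :
    ∃ n : ℕ, Module.finrank ℤ M ≤ n ∧
      -- (i)
      ∃ (τ' : KStructure k (Gm k' n)) (σ' : KStructure k (affineSp k' n)),
        τ'.IsGroupStructure ∧ IsKMorphism τ' σ' (gmInclusion k' n) ∧
      -- (ii)
      ∃ j : splitTorus k' M ⟶ Gm k' n,
        IsMonHom j ∧ IsClosedImmersion j.left ∧ IsKMorphism τ τ' j ∧
      -- (iii)
      ActsOver τ σ' (restrictedAction j) ∧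
      ∃ i : X ⟶ affineSp k' n,
        IsClosedImmersion i.left ∧ IsKMorphism σ σ' i ∧
        ModObj.smul (M := splitTorus k' M) (X := X) ≫ i =
          (splitTorus k' M ◁ i) ≫ restrictedAction j ∧
        (Set.range i.left ∩ Set.range (gmInclusion k' n).left).Nonempty ∧
        weightCone (restrictedAction j) =
          weightCone (ModObj.smul (M := splitTorus k' M) (X := X)) := by
  have := hX.locallyOfFiniteType
  have := hX.geometricallyIntegral
  have : IsIntegral X.left := GeometricallyIntegral.isIntegral_of_subsingleton X.hom
  obtain ⟨n, f, w, π, h0, hf, hgen, hπ, hw, hE⟩ := exists_equivariant_generators hτ σ hact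
  obtain ⟨τ', hτ'⟩ := exists_Gm_structure π hE
  obtain ⟨σ', hσ'⟩ := exists_affineSp_structure π hE
  replace hτ' := act_appTop_gmFun hτ'
  replace hσ' := act_appTop_coordFun hσ'
  -- Every weight of `X` is a sum of the `w i`, so the image of `ℤ^n` contains all weights, and
  -- these generate `M` by effectiveness.
  have hsurj : Function.Surjective (weightMap w) := by
    rw [← AddMonoidHom.range_eq_top]
    exact heff.closure_weights_eq_top _ fun m g hg hg0 =>
      closure_range_le_range_weightMap w (hg.weight_mem_closure hf hgen hg0)
  refine ⟨n, ?_, τ', σ', isGroupStructure_of_act_appTop_gmFun hτ',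
    isKMorphism_gmInclusion hτ' hσ', torusHom k' w, isMonHom_torusHom w,
    isClosedImmersion_torusHom hsurj, isKMorphism_torusHom hτ hw hτ',
    actsOver_restrictedAction hw hσ', toAffineSp f, isClosedImmersion_toAffineSp hgen,
    isKMorphism_toAffineSp hπ hσ', comp_toAffineSp_eq hf, range_toAffineSp_inter_nonempty h0, ?_⟩
  · have := LinearMap.finrank_le_finrank_of_surjective
      (f := (weightMap w).toIntLinearMap) hsurj
    simpa using this
  · rw [weightCone_eq_hull hf h0 hgen, weightCone_eq_hull (isSemiInvariant_coordFun w)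
      coordFun_ne_zero surjective_eval₂Hom_coordFun]
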